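/- Let $1<B<2$. Let $0\le\kappa<\tfrac12$ and let $\omega=(\omega_i)_{i\ge1}$ be a centered Gaussian sequence with covariances $\mathbb E[\omega_i\omega_j]=\kappa^{d(i,j)}$ (with $0^0=1$, so that $\kappa=0$ is the i.i.d. case), where $d(i,j)$ is the smallest $p\ge0$ such that $i$ and $j$ lie in the same block $\{(k-1)2^p+1,\dots,k2^p\}$, $k\ge 1$. For $\beta>0$ and $h\in\mathbb R$ put $Z_0^{(i)}=e^{\beta\omega_i+h}$ and $$Z_{n+1}^{(i)}=\frac{Z_n^{(2i-1)}Z_n^{(2i)}+B-1}{B}\qquad(n\ge0,\ i\ge1),$$ and write $Z_n:=Z_n^{(1)}$. Let $$F(\beta,h)=\lim_{n\to\infty}2^{-n}\,\mathbb E[\log Z_n],\qquad h_c(\beta)=\inf\{h\in\mathbb R: F(\beta,h)>0\}$$ be the quenched free energy and the quenched critical point. Then, for every $B\in(1,2)$, there is a constant $c(B)<\infty$, depending only on $B$, such that for all $\kappa\in[0,\tfrac12)$, all such $\omega$ and all $\beta>0$ the following hold. 1. For every $h\in\mathbb R$, each $\log Z_n$ is integrable, the limit defining $F(\beta,h)$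 exists in $\mathbb R$, and almost surely $2^{-n}\log Z_n\to F(\beta,h)$. Moreover $h_c(\beta)$ is a genuine critical point: $F(\beta,h)=0$ for $h\le h_c(\beta)$ and $F(\beta,h)>0$ for $h>h_c(\beta)$. 2. For every $h\in\mathbb R$, $$F(\beta,h)\le\frac{c(B)}{\beta^2}\,\bigl(h-h_c(\beta)\bigr)_+^2 .$$ 3. The quenched critical exponent is at least $2$: for every $a<2$, $\ \dfrac{\log F(\beta,h)}{\log(h-h_c(\beta))}\ge a\ $ for all $h>h_c(\beta)$ close enough to $h_c(\beta)$. 4. If the critical exponent $\nu=\dfrac{\log 2}{\log(2/B)}$ of the pure model ($\beta=0$) satisfies $\nu<2$, disorder is relevant: $F(\beta,h)/(h-h_c(\beta))^{\nu}\to0$ as $h\searrow h_c(\beta)$, that is, the quenched free energy vanishes at its critical point faster than with the pure exponent. -/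

import Mathlib

open MeasureTheory ProbabilityTheory Filter Topology

noncomputable section

namespace HierPinning

/-- Hierarchical (binary tree) distance of the sites `i` and `j`, where `0, 1, 2, …` are the leaves
of the infinite binary tree: the smallest `p` such that `i` and `j` lie in the same block
`{k 2 ^ p, …, (k + 1) 2 ^ p - 1}`. (Sites and blocks are numbered from `0`.) -/
def treeDist (i j : ℕ) : ℕ := sInf {p : ℕ | i / 2 ^ p = j / 2 ^ p}

/-- `ω` is a centered Gaussian sequence with `E[ω i * ω j] = κ ^ d(i, j)`, `d` the tree distance
(in particular each `ω i` has variance `1`, and `κ = 0` is the i.i.d. case, since `0 ^ 0 = 1`). -/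
structure IsHierarchicalDisorder {Ω : Type*} [MeasurableSpace Ω]
    (κ : ℝ) (ω : ℕ → Ω → ℝ) (P : Measure Ω) : Prop where
  isGaussianProcess : IsGaussianProcess ω P
  mean_eq_zero : ∀ i, ∫ x, ω i x ∂P = 0
  covariance_eq : ∀ i j, ∫ x, ω i x * ω j x ∂P = κ ^ treeDist i j

/-- The partition function of the `i`-th block of size `2 ^ n` in the environment `w`. -/
def partitionFunction (B β h : ℝ) (w : ℕ → ℝ) : ℕ → ℕ → ℝ
  | 0, i => Real.exp (β * w i + h)
  | n + 1, i =>
      (partitionFunction B β h w n (2 * i) * partitionFunction B β h w n (2 * i + 1) + (B - 1)) / B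

/-- `log Z_n` as a random variable, `Z_n` being the partition function of the first block of
size `2 ^ n`. -/
def logPartitionFunction {Ω : Type*} (B β h : ℝ) (ω : ℕ → Ω → ℝ) (n : ℕ) (x : Ω) : ℝ :=
  Real.log (partitionFunction B β h (fun i => ω i x) n 0)

/-- The finite-volume quenched free energy `2 ^ (-n) * E[log Z_n]`. -/
def finiteFreeEnergy {Ω : Type*} [MeasurableSpace Ω] (B : ℝ) (ω : ℕ → Ω → ℝ) (P : Measure Ω)
    (β h : ℝ) (n : ℕ) : ℝ :=
  (∫ x, logPartitionFunction B β h ω n x ∂P) / 2 ^ n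

/-- The quenched free energy `F(β, h) = lim 2 ^ (-n) * E[log Z_n]`. -/
def freeEnergy {Ω : Type*} [MeasurableSpace Ω] (B : ℝ) (ω : ℕ → Ω → ℝ) (P : Measure Ω)
    (β h : ℝ) : ℝ :=
  limUnder atTop (finiteFreeEnergy B ω P β h)

/-- The quenched critical point `h_c(β)`: the threshold above which the free energy is positive. -/
def criticalPoint {Ω : Type*} [MeasurableSpace Ω] (B : ℝ) (ω : ℕ → Ω → ℝ) (P : Measure Ω)
    (β : ℝ) : ℝ :=
  sInf {h : ℝ | 0 < freeEnergy B ω P β h}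

/-- The critical exponent `ν = log 2 / log (2 / B)` of the pure model. -/
def pureExponent (B : ℝ) : ℝ := Real.log 2 / Real.log (2 / B)

end HierPinning

end

/-! The smoothing inequality comes from rare favourable blocks. Suppose F(β, h) = 0 and let F = F(β,
h + βt) > 0. Adding t to the disorder of a block of size 2^n amounts to replacing h by h + βt there,
so for large n the shifted block satisfies log Z_n ≥ 2^n F/2 with probability at least 1/2. The
shift is a one-dimensional Cameron–Martin change of measure, because the fluctuations in a block are
independent of its average (`lintegral_tilt`). Its density has second moment at most exp(t² 2^n),
since nonnegative correlations only increase the variance of the average. A second-moment argument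
over M ≥ exp(t² 2^n) well separated blocks then finds a good one in the original disorder, with
probability bounded below uniformly in n (`le_measureReal_exists_mem`); the separation and κ < 1/2
keep the densities of different blocks almost uncorrelated.

On the tree, a good block hands its log Z upwards at a cost of only C = log(B²/(B-1)) per generation
(`logZ_sub_le_logZ_add`). With M = 2^m and m about t² 2^n / log 2, climbing costs about C t² 2^n /
log 2. Superadditivity and F(β, h) = 0 force E[log Z_N] ≤ log B for every N
(`integral_logZ_sub_log_div_le`), so the gain 2^n F/2 exceeds this cost by o(2^n) at most. Hence F ≤
2Ct² / log 2, and h = h_c with t = (h' - h_c)/β gives the bound at h'.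

Almost sure convergence rests on a variance recursion for log Z_n with factor below 4
(`exists_variance_logZ_le`). The critical point is finite by the annealed bound on one side and a
first-generation bound on the other; F vanishes there because it is 1-Lipschitz in h. The statements
on exponents follow from the quadratic bound by calculus. -/

namespace HierPinning

/-! ### Deterministic bounds on the recursion -/

section Deterministic

variable {B β h : ℝ}

theorem partitionFunction_pos (hB : 1 < B) (β h : ℝ) (w : ℕ → ℝ) (n i : ℕ) :
    0 < partitionFunction B β h w n i := by
  induction n generalizing i with
  | zero => exact Real.exp_pos _
  | succ n ih =>
    have h1 := mul_pos (ih (2 * i)) (ih (2 * i + 1))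
    exact div_pos (by linarith) (by linarith)

/-- Generation 0 has no floor uniform in the environment unless β = 0; hence the indices `n + 1` and
`n + 2` in the bounds below. -/
theorem le_partitionFunction_succ (hB : 1 < B) (β h : ℝ) (w : ℕ → ℝ) (n i : ℕ) :
    (B - 1) / B ≤ partitionFunction B β h w (n + 1) i := by
  have h1 := mul_pos (partitionFunction_pos hB β h w n (2 * i))
    (partitionFunction_pos hB β h w n (2 * i + 1))
  exact div_le_div_of_nonneg_right (by linarith) (by linarith)

theorem measurable_partitionFunction (B β h : ℝ) (n i : ℕ) :
    Measurable fun w : ℕ → ℝ => partitionFunction B β h w n i := by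
  induction n generalizing i with
  | zero => simp only [partitionFunction]; fun_prop
  | succ n ih =>
    have h1 := ih (2 * i)
    have h2 := ih (2 * i + 1)
    simp only [partitionFunction]; fun_prop

theorem partitionFunction_congr {w w' : ℕ → ℝ} {n i : ℕ}
    (hw : ∀ k, k / 2 ^ n = i → w k = w' k) :
    partitionFunction B β h w n i = partitionFunction B β h w' n i := by
  induction n generalizing i with
  | zero => simp [partitionFunction, hw i (by simp)]
  | succ n ih =>
    simp only [partitionFunction]
    rw [ih fun k hk => hw k (by rw [pow_succ, ← Nat.div_div_eq_div_mul, hk]; omega),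
      ih fun k hk => hw k (by rw [pow_succ, ← Nat.div_div_eq_div_mul, hk]; omega)]

theorem partitionFunction_translate (w : ℕ → ℝ) (n i j : ℕ) :
    partitionFunction B β h w n (j + i) =
      partitionFunction B β h (fun k => w (j * 2 ^ n + k)) n i := by
  induction n generalizing i j with
  | zero => simp [partitionFunction]
  | succ n ih =>
    simp only [partitionFunction]
    rw [show 2 * (j + i) = 2 * j + 2 * i by ring, ih, add_assoc, ih]
    simp only [pow_succ, show 2 * j * 2 ^ n = j * (2 ^ n * 2) by ring]

/-- The environment seen in the `j`-th block of size `2 ^ n`, continued periodically. -/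
def blockEnv (n j : ℕ) (w : ℕ → ℝ) : ℕ → ℝ := fun k => w (j * 2 ^ n + k % 2 ^ n)

theorem partitionFunction_blockEnv (w : ℕ → ℝ) (n j : ℕ) :
    partitionFunction B β h (blockEnv n j w) n 0 = partitionFunction B β h w n j := by
  conv_rhs => rw [← add_zero j, partitionFunction_translate]
  refine partitionFunction_congr fun k hk => ?_
  rw [Nat.div_eq_zero_iff] at hk
  have : k < 2 ^ n := by simpa using hk
  simp [blockEnv, Nat.mod_eq_of_lt this]

/-- This is what converts a shift of the disorder into a change of `h`. -/
theorem partitionFunction_add_const (w : ℕ → ℝ) (s : ℝ) (n i : ℕ) :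
    partitionFunction B β h (fun k => w k + s) n i = partitionFunction B β (h + β * s) w n i := by
  induction n generalizing i with
  | zero => simp only [partitionFunction]; ring_nf
  | succ n ih => simp only [partitionFunction, ih]

theorem partitionFunction_mono (hB : 1 < B) {h' : ℝ} (hh : h ≤ h') (w : ℕ → ℝ) (n i : ℕ) :
    partitionFunction B β h w n i ≤ partitionFunction B β h' w n i := by
  induction n generalizing i with
  | zero => simp only [partitionFunction]; gcongr
  | succ n ih =>
    simp only [partitionFunction]
    have := (partitionFunction_pos hB β h w n (2 * i)).le
    have := (partitionFunction_pos hB β h' w n (2 * i)).le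
    have := (partitionFunction_pos hB β h w n (2 * i + 1)).le
    have := ih (2 * i)
    have := ih (2 * i + 1)
    gcongr

/-- Z_n is a polynomial of degree 2^n in exp h with nonnegative coefficients. -/
theorem partitionFunction_le_exp_mul (hB : 1 < B) {h' : ℝ} (hh : h ≤ h') (w : ℕ → ℝ) (n i : ℕ) :
    partitionFunction B β h' w n i ≤ Real.exp (2 ^ n * (h' - h)) * partitionFunction B β h w n i := by
  induction n generalizing i with
  | zero =>
    simp only [partitionFunction, ← Real.exp_add]
    refine Real.exp_le_exp.2 (le_of_eq ?_)
    simp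
    ring
  | succ n ih =>
    have h1 := partitionFunction_pos hB β h' w n (2 * i + 1)
    have h2 := partitionFunction_pos hB β h w n (2 * i)
    have h3 := mul_le_mul (ih (2 * i)) (ih (2 * i + 1)) h1.le (by positivity)
    have h4 : Real.exp (2 ^ (n + 1) * (h' - h)) =
        Real.exp (2 ^ n * (h' - h)) * Real.exp (2 ^ n * (h' - h)) := by
      rw [← Real.exp_add]; ring_nf
    have h5 : 1 ≤ Real.exp (2 ^ (n + 1) * (h' - h)) :=
      Real.one_le_exp (mul_nonneg (by positivity) (by linarith))
    simp only [partitionFunction]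
    rw [mul_div_assoc']
    refine div_le_div_of_nonneg_right ?_ (by linarith)
    rw [h4] at *
    nlinarith

/-- `log Z_n` of the `i`-th block in the environment `w`. -/
noncomputable def logZ (B β h : ℝ) (n i : ℕ) (w : ℕ → ℝ) : ℝ := Real.log (partitionFunction B β h w n i)

theorem measurable_logZ (B β h : ℝ) (n i : ℕ) : Measurable (logZ B β h n i) :=
  (measurable_partitionFunction B β h n i).log

theorem logZ_blockEnv (w : ℕ → ℝ) (n j : ℕ) :
    logZ B β h n 0 (blockEnv n j w) = logZ B β h n j w := by
  simp [logZ, partitionFunction_blockEnv]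

theorem logZ_add_const (w : ℕ → ℝ) (s : ℝ) (n i : ℕ) :
    logZ B β h n i (fun k => w k + s) = logZ B β (h + β * s) n i w := by
  simp [logZ, partitionFunction_add_const]

theorem logZ_mono (hB : 1 < B) {h' : ℝ} (hh : h ≤ h') (w : ℕ → ℝ) (n i : ℕ) :
    logZ B β h n i w ≤ logZ B β h' n i w :=
  Real.log_le_log (partitionFunction_pos hB ..) (partitionFunction_mono hB hh w n i)

theorem logZ_le_add (hB : 1 < B) {h' : ℝ} (hh : h ≤ h') (w : ℕ → ℝ) (n i : ℕ) :
    logZ B β h' n i w ≤ logZ B β h n i w + 2 ^ n * (h' - h) := by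
  have h1 := Real.log_le_log (partitionFunction_pos hB ..)
    (partitionFunction_le_exp_mul (β := β) hB hh w n i)
  rw [Real.log_mul (Real.exp_pos _).ne' (partitionFunction_pos hB ..).ne', Real.log_exp] at h1
  simp only [logZ]
  linarith

theorem abs_logZ_sub_le (hB : 1 < B) (h' : ℝ) (w : ℕ → ℝ) (n i : ℕ) :
    |logZ B β h' n i w - logZ B β h n i w| ≤ 2 ^ n * |h' - h| := by
  rcases le_total h h' with hh | hh
  · rw [abs_of_nonneg (sub_nonneg.2 hh), abs_of_nonneg (sub_nonneg.2 (logZ_mono hB hh w n i))]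
    linarith [logZ_le_add (β := β) hB hh w n i]
  · rw [abs_of_nonpos (sub_nonpos.2 hh), abs_of_nonpos (sub_nonpos.2 (logZ_mono hB hh w n i))]
    linarith [logZ_le_add (β := β) hB hh w n i]

theorem logZ_zero (w : ℕ → ℝ) (i : ℕ) : logZ B β h 0 i w = β * w i + h := by
  simp [logZ, partitionFunction]

theorem le_logZ_succ (hB : 1 < B) (w : ℕ → ℝ) (n i : ℕ) :
    Real.log ((B - 1) / B) ≤ logZ B β h (n + 1) i w :=
  Real.log_le_log (div_pos (by linarith) (by linarith)) (le_partitionFunction_succ hB ..)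

theorem add_sub_log_le_logZ_succ (hB : 1 < B) (w : ℕ → ℝ) (n i : ℕ) :
    logZ B β h n (2 * i) w + logZ B β h n (2 * i + 1) w - Real.log B ≤ logZ B β h (n + 1) i w := by
  have h1 := partitionFunction_pos hB β h w n (2 * i)
  have h2 := partitionFunction_pos hB β h w n (2 * i + 1)
  simp only [logZ]
  rw [← Real.log_mul h1.ne' h2.ne', ← Real.log_div (by positivity) (by linarith)]
  refine Real.log_le_log (by positivity) ?_
  simp only [partitionFunction]
  gcongr
  linarith

/-- Both factors are at least (B - 1)/B, so the additive B - 1 is at most a constant multiple of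
their product. -/
theorem logZ_succ_succ_le (hB : 1 < B) (w : ℕ → ℝ) (n i : ℕ) :
    logZ B β h (n + 2) i w ≤ logZ B β h (n + 1) (2 * i) w + logZ B β h (n + 1) (2 * i + 1) w +
      Real.log (1 + B ^ 2 / (B - 1)) := by
  have h1 := le_partitionFunction_succ hB β h w n (2 * i)
  have h2 := le_partitionFunction_succ hB β h w n (2 * i + 1)
  have hB1 : 0 < B - 1 := by linarith
  have h0 : 0 < (B - 1) / B := by positivity
  simp only [logZ]
  have p1 := h0.trans_le h1
  have p2 := h0.trans_le h2
  rw [← Real.log_mul p1.ne' p2.ne', ← Real.log_mul (by positivity) (by positivity)]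
  refine Real.log_le_log (partitionFunction_pos hB ..) ?_
  rw [show n + 2 = (n + 1) + 1 from rfl, partitionFunction]
  set x := partitionFunction B β h w (n + 1) (2 * i)
  set y := partitionFunction B β h w (n + 1) (2 * i + 1)
  have h3 : (B - 1) / B * ((B - 1) / B) ≤ x * y := by gcongr
  have h4 : B - 1 ≤ x * y * (B ^ 2 / (B - 1)) := by
    calc B - 1 = (B - 1) / B * ((B - 1) / B) * (B ^ 2 / (B - 1)) := by field_simp
      _ ≤ _ := by gcongr
  refine (div_le_self ?_ hB.le).trans ?_
  · positivity
  · linarith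

/-- The two halves of a block interact by at most a constant. -/
theorem abs_logZ_succ_succ_sub_le (hB : 1 < B) (w : ℕ → ℝ) (n i : ℕ) :
    |logZ B β h (n + 2) i w - (logZ B β h (n + 1) (2 * i) w + logZ B β h (n + 1) (2 * i + 1) w)| ≤
      Real.log B + Real.log (1 + B ^ 2 / (B - 1)) := by
  have h1 := logZ_succ_succ_le (β := β) (h := h) hB w n i
  have h2 := add_sub_log_le_logZ_succ (β := β) (h := h) hB w (n + 1) i
  have h3 := Real.log_nonneg hB.le
  have h4 : 0 ≤ B ^ 2 / (B - 1) := div_nonneg (by positivity) (by linarith)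
  have h5 : 0 ≤ Real.log (1 + B ^ 2 / (B - 1)) := Real.log_nonneg (by linarith)
  rw [abs_le]
  constructor
  · rw [show n + 2 = n + 1 + 1 from rfl]
    linarith
  · linarith

theorem abs_logZ_succ_le (hB : 1 < B) (w : ℕ → ℝ) (n i : ℕ) :
    |logZ B β h (n + 1) i w| ≤ |logZ B β h n (2 * i) w| + |logZ B β h n (2 * i + 1) w| -
      Real.log ((B - 1) / B) := by
  have hB1 : 0 < B - 1 := by linarith
  have h0 : 0 < (B - 1) / B := by positivity
  have h1 : Real.log ((B - 1) / B) ≤ 0 :=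
    Real.log_nonpos h0.le ((div_le_one (by linarith)).2 (by linarith))
  have h2 := le_logZ_succ (β := β) (h := h) hB w n i
  have a0 := abs_nonneg (logZ B β h n (2 * i) w)
  have b0 := abs_nonneg (logZ B β h n (2 * i + 1) w)
  rw [abs_le]
  refine ⟨by linarith, ?_⟩
  suffices logZ B β h (n + 1) i w ≤ |logZ B β h n (2 * i) w| + |logZ B β h n (2 * i + 1) w| by
    linarith
  rw [logZ, Real.log_le_iff_le_exp (partitionFunction_pos hB ..), Real.exp_add]
  have e1 : partitionFunction B β h w n (2 * i) ≤ Real.exp |logZ B β h n (2 * i) w| := by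
    rw [← Real.log_le_iff_le_exp (partitionFunction_pos hB ..)]; exact le_abs_self _
  have e2 : partitionFunction B β h w n (2 * i + 1) ≤ Real.exp |logZ B β h n (2 * i + 1) w| := by
    rw [← Real.log_le_iff_le_exp (partitionFunction_pos hB ..)]; exact le_abs_self _
  have f1 := Real.one_le_exp a0
  have f2 := Real.one_le_exp b0
  have f3 := mul_le_mul e1 e2 (partitionFunction_pos hB ..).le (by positivity)
  rw [partitionFunction, div_le_iff₀ (by linarith)]
  nlinarith [mul_le_mul f1 f2 zero_le_one (by positivity)]

/-- A block keeps the partition function of a sub-block up to a constant factor per generation. -/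
theorem logZ_sub_le_logZ_add (hB : 1 < B) (w : ℕ → ℝ) (n k i : ℕ) :
    logZ B β h (n + 1) i w - k * Real.log (B ^ 2 / (B - 1)) ≤
      logZ B β h (n + 1 + k) (i / 2 ^ k) w := by
  induction k with
  | zero => simp
  | succ k ih =>
    have hB1 : 0 < B - 1 := by linarith
    have h1 := add_sub_log_le_logZ_succ (β := β) (h := h) hB w (n + 1 + k) (i / 2 ^ (k + 1))
    have h2 : ∀ j, Real.log ((B - 1) / B) ≤ logZ B β h (n + 1 + k) j w := fun j => by
      rw [show n + 1 + k = n + k + 1 by omega]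
      exact le_logZ_succ hB w (n + k) j
    -- The cost of one generation: log B for the denominator, and the floor (B - 1)/B in place of
    -- the sibling block.
    have h3 : Real.log (B ^ 2 / (B - 1)) = Real.log B - Real.log ((B - 1) / B) := by
      rw [← Real.log_div (by linarith) (by positivity)]
      congr 1
      field_simp
    have h4 : i / 2 ^ k = 2 * (i / 2 ^ (k + 1)) ∨ i / 2 ^ k = 2 * (i / 2 ^ (k + 1)) + 1 := by
      rw [pow_succ, ← Nat.div_div_eq_div_mul]; omega
    rw [← add_assoc]
    push_cast
    rcases h4 with h4 | h4
    · rw [h4] at ih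
      linarith [h2 (2 * (i / 2 ^ (k + 1)) + 1)]
    · rw [h4] at ih
      linarith [h2 (2 * (i / 2 ^ (k + 1)))]

end Deterministic

/-! ### Tree distance and block sums of covariances -/

section TreeDistance

/-- Ensures that the infimum defining `treeDist` is attained and is not the default value 0. -/
theorem exists_div_two_pow_eq (i j : ℕ) : ∃ p, i / 2 ^ p = j / 2 ^ p :=
  ⟨i + j, by
    rw [Nat.div_eq_of_lt, Nat.div_eq_of_lt] <;>
    exact lt_of_le_of_lt (by omega) (Nat.lt_two_pow_self (n := i + j))⟩

theorem treeDist_le_iff {i j p : ℕ} : treeDist i j ≤ p ↔ i / 2 ^ p = j / 2 ^ p := by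
  constructor
  · intro hp
    have h1 : i / 2 ^ treeDist i j = j / 2 ^ treeDist i j := Nat.sInf_mem (exists_div_two_pow_eq i j)
    obtain ⟨q, rfl⟩ := Nat.exists_eq_add_of_le hp
    rw [pow_add, ← Nat.div_div_eq_div_mul, ← Nat.div_div_eq_div_mul, h1]
  · exact fun hp => Nat.sInf_le hp

theorem treeDist_comm (i j : ℕ) : treeDist i j = treeDist j i :=
  eq_of_forall_ge_iff fun p => by rw [treeDist_le_iff, treeDist_le_iff, eq_comm]

theorem treeDist_self (i : ℕ) : treeDist i i = 0 := Nat.le_zero.1 (treeDist_le_iff.2 rfl)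

/-- Sites in different blocks of size `2 ^ n`. -/
theorem treeDist_of_ne {n i j : ℕ} (hij : i / 2 ^ n ≠ j / 2 ^ n) :
    treeDist i j = n + treeDist (i / 2 ^ n) (j / 2 ^ n) := by
  refine eq_of_forall_ge_iff fun p => ?_
  rcases le_total n p with hp | hp
  · obtain ⟨q, rfl⟩ := Nat.exists_eq_add_of_le hp
    rw [treeDist_le_iff, add_le_add_iff_left, treeDist_le_iff, pow_add,
      ← Nat.div_div_eq_div_mul, ← Nat.div_div_eq_div_mul]
  · refine iff_of_false (fun h => hij (treeDist_le_iff.1 (h.trans hp))) fun h => hij ?_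
    have h0 : treeDist (i / 2 ^ n) (j / 2 ^ n) = 0 := by omega
    simpa using treeDist_le_iff.1 h0.le

/-- The tree distance inside a block of size `2 ^ n` does not depend on the block. -/
theorem treeDist_block {n j i k : ℕ} (hi : i < 2 ^ n) (hk : k < 2 ^ n) :
    treeDist (j * 2 ^ n + i) (j * 2 ^ n + k) = treeDist i k := by
  have hn : ∀ l < 2 ^ n, (j * 2 ^ n + l) / 2 ^ n = j := fun l hl => by
    rw [mul_comm, Nat.mul_add_div (by positivity), Nat.div_eq_of_lt hl, add_zero]
  refine eq_of_forall_ge_iff fun p => ?_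
  rcases le_total n p with hp | hp
  · refine iff_of_true ((treeDist_le_iff.2 ?_).trans hp) ((treeDist_le_iff.2 ?_).trans hp)
    · rw [hn i hi, hn k hk]
    · rw [Nat.div_eq_of_lt hi, Nat.div_eq_of_lt hk]
  · obtain ⟨q, rfl⟩ := Nat.exists_eq_add_of_le hp
    have h2 : ∀ l, (j * 2 ^ (p + q) + l) / 2 ^ p = j * 2 ^ q + l / 2 ^ p := fun l => by
      rw [pow_add, show j * (2 ^ p * 2 ^ q) + l = 2 ^ p * (j * 2 ^ q) + l by ring,
        Nat.mul_add_div (by positivity)]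
    rw [treeDist_le_iff, treeDist_le_iff, h2, h2, add_right_inj]

theorem treeDist_halves {n i k : ℕ} (hi : i < 2 ^ n) (hk : k < 2 ^ n) :
    treeDist i (2 ^ n + k) = n + 1 := by
  have h1 : i / 2 ^ n = 0 := Nat.div_eq_of_lt hi
  have h2 : (2 ^ n + k) / 2 ^ n = 1 := by
    rw [Nat.add_div_left _ (by positivity), Nat.div_eq_of_lt hk]
  have h3 : treeDist 0 1 = 1 := by
    refine le_antisymm (treeDist_le_iff.2 (by simp)) (Nat.pos_of_ne_zero fun h => ?_)
    simpa using treeDist_le_iff.1 h.le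
  rw [treeDist_of_ne (n := n) (by omega), h1, h2, h3]

/-- The sum of `κ ^ d(i, ·)` over a block of size `2 ^ n` containing `i`. -/
noncomputable def rowSum (κ : ℝ) (n : ℕ) : ℝ := 1 + ∑ p ∈ Finset.range n, 2 ^ p * κ ^ (p + 1)

/-- The value does not depend on i: constant vectors are eigenvectors of the covariance matrix of a
block. This is why shifting a whole block by a constant only involves its average. -/
theorem sum_pow_treeDist (κ : ℝ) {n i : ℕ} (hi : i < 2 ^ n) :
    ∑ k ∈ Finset.range (2 ^ n), κ ^ treeDist i k = rowSum κ n := by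
  induction n generalizing i with
  | zero =>
    have : i = 0 := by simpa using hi
    simp [rowSum, this, treeDist_self]
  | succ n ih =>
    have hr : rowSum κ (n + 1) = rowSum κ n + 2 ^ n * κ ^ (n + 1) := by
      rw [rowSum, Finset.sum_range_succ, rowSum, add_assoc]
    rw [pow_succ, mul_two, Finset.sum_range_add, hr]
    rcases lt_or_ge i (2 ^ n) with h | h
    · rw [ih h]
      congr 1
      rw [Finset.sum_congr rfl fun k hk => by rw [treeDist_halves h (Finset.mem_range.1 hk)]]
      simp
    · obtain ⟨l, rfl⟩ := Nat.exists_eq_add_of_le h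
      have hl : l < 2 ^ n := by rw [pow_succ] at hi; omega
      rw [add_comm (rowSum κ n)]
      congr 1
      · rw [Finset.sum_congr rfl fun k hk => by
          rw [treeDist_comm, treeDist_halves (Finset.mem_range.1 hk) hl]]
        simp
      · rw [← ih hl]
        refine Finset.sum_congr rfl fun k hk => ?_
        have := treeDist_block (j := 1) hl (Finset.mem_range.1 hk)
        rw [one_mul] at this
        rw [this]

theorem one_le_rowSum {κ : ℝ} (hκ : 0 ≤ κ) (n : ℕ) : 1 ≤ rowSum κ n :=
  le_add_of_nonneg_right (Finset.sum_nonneg fun p _ => by positivity)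

/-- The sum is κ times a geometric sum of ratio 2κ < 1, so correlations are summable. -/
theorem rowSum_le {κ : ℝ} (hκ : 0 ≤ κ) (hκ2 : κ < 1 / 2) (n : ℕ) :
    rowSum κ n ≤ 1 + (1 - 2 * κ)⁻¹ := by
  rw [rowSum, ← tsum_geometric_of_lt_one (by linarith) (by linarith : 2 * κ < 1)]
  gcongr
  refine le_trans (Finset.sum_le_sum fun p _ => ?_)
    ((summable_geometric_of_lt_one (by linarith) (by linarith)).sum_le_tsum (Finset.range n)
      fun p _ => by positivity)
  rw [mul_pow, pow_succ, ← mul_assoc]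
  exact mul_le_of_le_one_right (by positivity) (by linarith)

/-- The variance of the average of the disorder over a block of size `2 ^ n`. -/
noncomputable def avgVar (κ : ℝ) (n : ℕ) : ℝ := rowSum κ n / 2 ^ n

/-- Nonnegative correlations make a shift of the average no more expensive than for independent
disorder. -/
theorem inv_two_pow_le_avgVar {κ : ℝ} (hκ : 0 ≤ κ) (n : ℕ) : (2 ^ n)⁻¹ ≤ avgVar κ n := by
  rw [avgVar, inv_eq_one_div]
  gcongr
  exact one_le_rowSum hκ n

theorem avgVar_pos {κ : ℝ} (hκ : 0 ≤ κ) (n : ℕ) : 0 < avgVar κ n :=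
  lt_of_lt_of_le (by positivity) (inv_two_pow_le_avgVar hκ n)

end TreeDistance

/-! ### Gaussian structure of a block -/

section Gaussian

variable {Ω : Type*} [MeasurableSpace Ω] {P : Measure Ω} {ω : ℕ → Ω → ℝ} {κ : ℝ}

/-- Indexing by all coefficient vectors makes any family of finite linear combinations a reindexing
of one Gaussian process, so that uncorrelated families are independent. -/
theorem _root_.ProbabilityTheory.IsGaussianProcess.linearCombination
    (hω : IsGaussianProcess ω P) :
    IsGaussianProcess (fun (c : ℕ →₀ ℝ) x => c.sum fun i a => a * ω i x) P := by
  refine hω.of_isGaussianProcess fun c => ⟨c.support, ∑ i : c.support,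
    c i • (ContinuousLinearMap.proj i : (c.support → ℝ) →L[ℝ] ℝ), fun x => ?_⟩
  simp [Finsupp.sum, Finset.sum_attach c.support fun i => c i * ω i x]

/-- The average of the environment over the `j`-th block of size `2 ^ n`. -/
noncomputable def blockAvg (n j : ℕ) (w : ℕ → ℝ) : ℝ :=
  (2 ^ n)⁻¹ * ∑ i ∈ Finset.range (2 ^ n), w (j * 2 ^ n + i)

theorem measurable_blockAvg (n j : ℕ) : Measurable (blockAvg n j) := by
  unfold blockAvg; fun_prop

theorem measurable_blockEnv (n j : ℕ) : Measurable (blockEnv n j) := by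
  unfold blockEnv; fun_prop

/-- The coefficients of `blockAvg`. -/
noncomputable def avgCoeff (n j : ℕ) : ℕ →₀ ℝ :=
  ∑ i ∈ Finset.range (2 ^ n), Finsupp.single (j * 2 ^ n + i) (2 ^ n)⁻¹

theorem linComb_add (c d : ℕ →₀ ℝ) (w : ℕ → ℝ) :
    ((c + d).sum fun i a => a * w i) = (c.sum fun i a => a * w i) + d.sum fun i a => a * w i :=
  Finsupp.sum_add_index' (by simp) (by intros; ring)

theorem linComb_sub (c d : ℕ →₀ ℝ) (w : ℕ → ℝ) :
    ((c - d).sum fun i a => a * w i) = (c.sum fun i a => a * w i) - d.sum fun i a => a * w i :=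
  Finsupp.sum_sub_index (by intros; ring)

theorem linComb_smul (r : ℝ) (c : ℕ →₀ ℝ) (w : ℕ → ℝ) :
    ((r • c).sum fun i a => a * w i) = r * c.sum fun i a => a * w i := by
  rw [Finsupp.sum_smul_index' (by simp), Finsupp.mul_sum]
  simp [mul_assoc]

theorem linComb_single (i : ℕ) (w : ℕ → ℝ) :
    ((Finsupp.single i (1 : ℝ)).sum fun i a => a * w i) = w i := by
  simp

theorem linComb_avgCoeff (n j : ℕ) (w : ℕ → ℝ) :
    ((avgCoeff n j).sum fun i a => a * w i) = blockAvg n j w := by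
  rw [avgCoeff, blockAvg, ← Finsupp.sum_finsetSum_index (by simp) (by intros; ring),
    Finset.mul_sum]
  simp

namespace IsHierarchicalDisorder

variable (hω : IsHierarchicalDisorder κ ω P)
include hω

theorem isProbabilityMeasure : IsProbabilityMeasure P := hω.isGaussianProcess.isProbabilityMeasure

theorem aemeasurable (i : ℕ) : AEMeasurable (ω i) P := hω.isGaussianProcess.aemeasurable i

theorem aemeasurable_env : AEMeasurable (fun x i => ω i x) P := aemeasurable_pi_lambda _ hω.aemeasurable

theorem memLp_two (i : ℕ) : MemLp (ω i) 2 P := (hω.isGaussianProcess.hasGaussianLaw_eval i).memLp_two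

theorem cov_eq (i j : ℕ) : cov[ω i, ω j; P] = κ ^ treeDist i j := by
  have := hω.isProbabilityMeasure
  rw [covariance_eq_sub (hω.memLp_two i) (hω.memLp_two j), hω.mean_eq_zero, hω.mean_eq_zero]
  simpa using hω.covariance_eq i j

theorem memLp_two_blockAvg (n j : ℕ) : MemLp (fun x => blockAvg n j (fun i => ω i x)) 2 P := by
  simp only [blockAvg]
  exact (memLp_finsetSum _ fun i _ => hω.memLp_two _).const_mul _

theorem mean_blockAvg (n j : ℕ) : ∫ x, blockAvg n j (fun i => ω i x) ∂P = 0 := by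
  have := hω.isProbabilityMeasure
  simp only [blockAvg]
  rw [integral_const_mul, integral_finsetSum _ fun i _ => (hω.memLp_two _).integrable (by norm_num)]
  simp [hω.mean_eq_zero]

theorem cov_blockAvg (k n j : ℕ) :
    cov[ω k, fun x => blockAvg n j (fun i => ω i x); P] =
      (2 ^ n)⁻¹ * ∑ i ∈ Finset.range (2 ^ n), κ ^ treeDist k (j * 2 ^ n + i) := by
  have := hω.isProbabilityMeasure
  simp only [blockAvg]
  rw [covariance_const_mul_right, covariance_fun_sum_right' (fun i _ => hω.memLp_two _) (hω.memLp_two k)]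
  simp [hω.cov_eq]

theorem cov_blockAvg_of_mem {n j k : ℕ} (hk : k < 2 ^ n) :
    cov[ω (j * 2 ^ n + k), fun x => blockAvg n j (fun i => ω i x); P] = avgVar κ n := by
  rw [hω.cov_blockAvg, avgVar, ← sum_pow_treeDist κ hk, div_eq_inv_mul]
  congr 1
  exact Finset.sum_congr rfl fun i hi => by rw [treeDist_block hk (Finset.mem_range.1 hi)]

theorem cov_blockAvg_of_ne {n j k : ℕ} (hk : k / 2 ^ n ≠ j) :
    cov[ω k, fun x => blockAvg n j (fun i => ω i x); P] =
      κ ^ (n + treeDist (k / 2 ^ n) j) := by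
  rw [hω.cov_blockAvg, Finset.sum_congr rfl fun i hi => ?_]
  · rw [Finset.sum_const, Finset.card_range, nsmul_eq_mul]
    push_cast
    rw [inv_mul_cancel_left₀ (by positivity)]
  · have : (j * 2 ^ n + i) / 2 ^ n = j := by
      rw [mul_comm, Nat.mul_add_div (by positivity), Nat.div_eq_of_lt (Finset.mem_range.1 hi),
        add_zero]
    rw [treeDist_of_ne (by rwa [this]), this]

theorem cov_blockAvg_blockAvg (n j j' : ℕ) :
    cov[fun x => blockAvg n j (fun i => ω i x), fun x => blockAvg n j' (fun i => ω i x); P] =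
      if j = j' then avgVar κ n else κ ^ (n + treeDist j j') := by
  have := hω.isProbabilityMeasure
  have hc : ∀ i ∈ Finset.range (2 ^ n), cov[ω (j * 2 ^ n + i),
      fun x => blockAvg n j' (fun i => ω i x); P] =
      if j = j' then avgVar κ n else κ ^ (n + treeDist j j') := by
    intro i hi
    have hd : (j * 2 ^ n + i) / 2 ^ n = j := by
      rw [mul_comm, Nat.mul_add_div (by positivity), Nat.div_eq_of_lt (Finset.mem_range.1 hi),
        add_zero]
    split_ifs with h
    · subst h; exact hω.cov_blockAvg_of_mem (Finset.mem_range.1 hi)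
    · rw [hω.cov_blockAvg_of_ne (by rwa [hd]), hd]
  conv_lhs => arg 1; unfold blockAvg
  rw [covariance_const_mul_left, covariance_fun_sum_left' (fun i _ => hω.memLp_two _)
    (hω.memLp_two_blockAvg n j'), Finset.sum_congr rfl hc, Finset.sum_const, Finset.card_range,
    nsmul_eq_mul]
  push_cast
  rw [inv_mul_cancel_left₀ (by positivity)]

/-- Two families of linear combinations of the disorder are independent if uncorrelated. -/
theorem indepFun_of_cov {S T : Type*} {X : S → Ω → ℝ} {Y : T → Ω → ℝ} (f : S → ℕ →₀ ℝ)
    (g : T → ℕ →₀ ℝ) (hX : ∀ s x, X s x = (f s).sum fun i a => a * ω i x)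
    (hY : ∀ t x, Y t x = (g t).sum fun i a => a * ω i x) (h : ∀ s t, cov[X s, Y t; P] = 0) :
    IndepFun (fun x s => X s x) (fun x t => Y t x) P := by
  have hG := hω.isGaussianProcess.linearCombination
  obtain rfl : X = fun s x => (f s).sum fun i a => a * ω i x := by ext; apply hX
  obtain rfl : Y = fun t x => (g t).sum fun i a => a * ω i x := by ext; apply hY
  refine IsGaussianProcess.indepFun_of_covariance_eq_zero ?_ (fun s => hG.aemeasurable (f s))
    (fun t => hG.aemeasurable (g t)) h
  have hfg := hG.comp_right (Sum.elim f g)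
  rwa [show (fun (c : ℕ →₀ ℝ) x => c.sum fun i a => a * ω i x) ∘ Sum.elim f g = Sum.elim
    (fun s x => (f s).sum fun i a => a * ω i x) (fun t x => (g t).sum fun i a => a * ω i x) from
    funext fun s => by cases s <;> rfl] at hfg

/-- The fluctuations in a block around its average are independent of the average. -/
theorem indepFun_blockEnv_sub_blockAvg (n j : ℕ) :
    IndepFun (fun x i => blockEnv n j (fun k => ω k x) i - blockAvg n j (fun k => ω k x))
      (fun x => blockAvg n j (fun k => ω k x)) P := by
  have := hω.isProbabilityMeasure
  have hi := hω.indepFun_of_cov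
    (X := fun i x => blockEnv n j (fun k => ω k x) i - blockAvg n j (fun k => ω k x))
    (Y := fun (_ : Unit) x => blockAvg n j (fun k => ω k x))
    (fun i => Finsupp.single (j * 2 ^ n + i % 2 ^ n) 1 - avgCoeff n j)
    (fun _ => avgCoeff n j)
    (fun i x => by rw [linComb_sub, linComb_avgCoeff, linComb_single, blockEnv])
    (fun _ x => by rw [linComb_avgCoeff]) (fun i _ => ?_)
  · exact hi.comp measurable_id (measurable_pi_apply ())
  · have h1 : cov[ω (j * 2 ^ n + i % 2 ^ n), fun x => blockAvg n j (fun k => ω k x); P] =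
        avgVar κ n := hω.cov_blockAvg_of_mem (Nat.mod_lt _ (by positivity))
    have h2 := hω.cov_blockAvg_blockAvg n j j
    rw [if_pos rfl] at h2
    unfold blockEnv
    rw [covariance_fun_sub_left (hω.memLp_two _) (hω.memLp_two_blockAvg n j) (hω.memLp_two_blockAvg n j),
      h1, h2, sub_self]

/-- Removing a multiple of the average of the first half of a block makes its second half
independent of the first. -/
theorem indepFun_blockEnv_zero_one (hκ : 0 ≤ κ) (n : ℕ) :
    IndepFun (fun x => blockEnv n 0 (fun k => ω k x))
      (fun x i => blockEnv n 1 (fun k => ω k x) i -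
        κ ^ (n + 1) / avgVar κ n * blockAvg n 0 (fun k => ω k x)) P := by
  have := hω.isProbabilityMeasure
  have hlt : ∀ i, i % 2 ^ n < 2 ^ n := fun i => Nat.mod_lt _ (by positivity)
  refine hω.indepFun_of_cov (X := fun i x => blockEnv n 0 (fun k => ω k x) i)
    (Y := fun i x => blockEnv n 1 (fun k => ω k x) i -
        κ ^ (n + 1) / avgVar κ n * blockAvg n 0 (fun k => ω k x))
    (fun i => Finsupp.single (0 * 2 ^ n + i % 2 ^ n) 1)
    (fun i => Finsupp.single (1 * 2 ^ n + i % 2 ^ n) 1 - (κ ^ (n + 1) / avgVar κ n) • avgCoeff n 0)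
    (fun i x => by rw [linComb_single, blockEnv])
    (fun i x => by rw [linComb_sub, linComb_smul, linComb_avgCoeff, linComb_single, blockEnv])
    fun i k => ?_
  have h1 : cov[ω (0 * 2 ^ n + i % 2 ^ n), fun x => blockAvg n 0 (fun k => ω k x); P] =
      avgVar κ n := hω.cov_blockAvg_of_mem (hlt i)
  have h2 : cov[ω (0 * 2 ^ n + i % 2 ^ n), ω (1 * 2 ^ n + k % 2 ^ n); P] = κ ^ (n + 1) := by
    rw [hω.cov_eq, zero_mul, zero_add, one_mul, treeDist_halves (hlt i) (hlt k)]
  unfold blockEnv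
  rw [covariance_fun_sub_right (hω.memLp_two _) (hω.memLp_two _)
    ((hω.memLp_two_blockAvg n 0).const_mul _), covariance_const_mul_right, h1, h2,
    div_mul_cancel₀ _ (avgVar_pos hκ n).ne', sub_self]

/-- All blocks of the same size have the same law. -/
theorem map_blockEnv (n j : ℕ) :
    P.map (fun x => blockEnv n j (fun k => ω k x)) =
      P.map (fun x => blockEnv n 0 (fun k => ω k x)) := by
  have := hω.isProbabilityMeasure
  -- The block environment extends 2^n coordinates periodically, so it suffices to compare two
  -- finite-dimensional Gaussian laws, which are determined by means and covariances.
  let X : ℕ → Ω → Fin (2 ^ n) → ℝ := fun j x i => ω (j * 2 ^ n + i) x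
  let R : (↥(Finset.univ : Finset (Fin (2 ^ n))) → ℝ) →L[ℝ] Fin (2 ^ n) → ℝ :=
    ContinuousLinearMap.pi fun i => ContinuousLinearMap.proj ⟨i, Finset.mem_univ i⟩
  have hX : ∀ j, HasGaussianLaw (X j) P := fun j =>
    ((hω.isGaussianProcess.comp_right (fun i : Fin (2 ^ n) => j * 2 ^ n + (i : ℕ))).hasGaussianLaw
      Finset.univ).map R
  have hL : ∀ (j) (L : StrongDual ℝ (Fin (2 ^ n) → ℝ)),
      L ∘ X j = fun x => ∑ i, L (Pi.single i 1) * ω (j * 2 ^ n + i) x := by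
    intro j L
    ext x
    rw [Function.comp_apply, ← ContinuousLinearMap.coe_coe, LinearMap.pi_apply_eq_sum_univ]
    refine Finset.sum_congr rfl fun i _ => ?_
    rw [smul_eq_mul, mul_comm, ContinuousLinearMap.coe_coe]
    congr 2
    ext k
    simp [Pi.single_apply, eq_comm]
  have hmean : ∀ (j) (L : StrongDual ℝ (Fin (2 ^ n) → ℝ)), P[L ∘ X j] = 0 := by
    intro j L
    rw [hL, integral_finsetSum _ fun i _ =>
      ((hω.memLp_two _).integrable (by norm_num)).const_mul _]
    simp [integral_const_mul, hω.mean_eq_zero]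
  have hvar : ∀ (j) (L : StrongDual ℝ (Fin (2 ^ n) → ℝ)), Var[L ∘ X j; P] =
      ∑ i : Fin (2 ^ n), ∑ k : Fin (2 ^ n),
        L (Pi.single i 1) * (L (Pi.single k 1) * κ ^ treeDist i k) := by
    intro j L
    rw [hL, variance_fun_sum fun i => (hω.memLp_two _).const_mul _]
    refine Finset.sum_congr rfl fun i _ => Finset.sum_congr rfl fun k _ => ?_
    rw [covariance_const_mul_left, covariance_const_mul_right, hω.cov_eq, treeDist_block i.2 k.2]
  have hmap : P.map (X j) = P.map (X 0) := by
    have := Measure.isProbabilityMeasure_map (hX j).aemeasurable (μ := P)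
    have := Measure.isProbabilityMeasure_map (hX 0).aemeasurable (μ := P)
    refine Measure.ext_of_charFunDual ?_
    ext L
    rw [(hX j).charFunDual_map_eq, (hX 0).charFunDual_map_eq, hmean, hmean, hvar, hvar]
  let E : (Fin (2 ^ n) → ℝ) → ℕ → ℝ := fun u k => u ⟨k % 2 ^ n, Nat.mod_lt _ (by positivity)⟩
  have hE : Measurable E := by fun_prop
  have hEX : ∀ j, (fun x => blockEnv n j (fun k => ω k x)) = E ∘ X j := fun j => rfl
  rw [hEX, hEX, ← AEMeasurable.map_map_of_aemeasurable hE.aemeasurable (hX j).aemeasurable, hmap,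
    AEMeasurable.map_map_of_aemeasurable hE.aemeasurable (hX 0).aemeasurable]

theorem hasGaussianLaw_linComb (c : ℕ →₀ ℝ) :
    HasGaussianLaw (fun x => c.sum fun i a => a * ω i x) P :=
  hω.isGaussianProcess.linearCombination.hasGaussianLaw_eval c

theorem map_blockAvg (n j : ℕ) :
    P.map (fun x => blockAvg n j (fun k => ω k x)) = gaussianReal 0 (avgVar κ n).toNNReal := by
  have h1 := hω.hasGaussianLaw_linComb (avgCoeff n j)
  simp only [linComb_avgCoeff] at h1
  have h2 := hω.cov_blockAvg_blockAvg n j j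
  rw [if_pos rfl, covariance_self h1.aemeasurable] at h2
  rw [h1.map_eq_gaussianReal, hω.mean_blockAvg, h2]

end IsHierarchicalDisorder

end Gaussian

/-! ### Concentration of log Z -/

section Variance

variable {Ω : Type*} [MeasurableSpace Ω] {P : Measure Ω}

/-- Random variables with summable variances converge to their means almost surely. -/
theorem ae_tendsto_sub_integral_of_summable_variance [IsProbabilityMeasure P] {X : ℕ → Ω → ℝ}
    (hX : ∀ n, MemLp (X n) 2 P) (hs : Summable fun n => Var[X n; P]) :
    ∀ᵐ x ∂P, Tendsto (fun n => X n x - P[X n]) atTop (𝓝 0) := by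
  have hm : ∀ n, AEMeasurable (fun x => ‖X n x - P[X n]‖ₑ ^ 2) P := fun n =>
    ((hX n).aestronglyMeasurable.aemeasurable.sub_const _).enorm.pow_const 2
  -- By Tonelli the sum of the squared deviations has finite mean, so it is almost surely finite and
  -- its terms tend to 0.
  have h1 : ∫⁻ x, ∑' n, ‖X n x - P[X n]‖ₑ ^ 2 ∂P ≠ ⊤ := by
    rw [lintegral_tsum hm]
    have h2 : ∀ n, ∫⁻ x, ‖X n x - P[X n]‖ₑ ^ 2 ∂P = ENNReal.ofReal Var[X n; P] := fun n =>
      (hX n).ofReal_variance_eq.symm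
    simp_rw [h2]
    exact hs.tsum_ofReal_ne_top
  filter_upwards [ae_lt_top' (AEMeasurable.tsum hm) h1] with x hx
  have h3 := ENNReal.tendsto_atTop_zero_of_tsum_ne_top hx.ne
  have h4 : Tendsto (fun n => ((‖X n x - P[X n]‖ₑ ^ 2).toReal)) atTop (𝓝 0) := by
    exact (ENNReal.tendsto_toReal ENNReal.zero_ne_top).comp h3
  simp only [ENNReal.toReal_pow, toReal_enorm, Real.norm_eq_abs, sq_abs] at h4
  have h5 := h4.sqrt
  simp only [Real.sqrt_sq_eq_abs, Real.sqrt_zero] at h5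
  exact (tendsto_zero_iff_abs_tendsto_zero _).2 h5

/-- Expand Var[U/10 - e] ≥ 0. The factor 11/10 is chosen close enough to 1 to keep the final
recursion below 4. -/
theorem variance_add_le [IsProbabilityMeasure P] {U e : Ω → ℝ} (hU : MemLp U 2 P)
    (he : MemLp e 2 P) : Var[U + e; P] ≤ 11 / 10 * Var[U; P] + 11 * Var[e; P] := by
  have h1 := variance_nonneg ((1 / 10 : ℝ) • U - e) P
  rw [variance_sub (hU.const_smul _) he, variance_smul, covariance_smul_left] at h1
  rw [variance_add hU he]
  linarith

theorem two_mul_covariance_le [IsProbabilityMeasure P] {X Y : Ω → ℝ} (hX : MemLp X 2 P)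
    (hY : MemLp Y 2 P) : 2 * cov[X, Y; P] ≤ Var[X; P] + Var[Y; P] := by
  have h1 := variance_nonneg (X - Y) P
  rw [variance_sub hX hY] at h1
  linarith

variable {ω : ℕ → Ω → ℝ} {κ B : ℝ}

namespace IsHierarchicalDisorder

variable (hω : IsHierarchicalDisorder κ ω P)
include hω

theorem aemeasurable_logZ (B β h : ℝ) (n i : ℕ) :
    AEMeasurable (fun x => logZ B β h n i (fun k => ω k x)) P :=
  (measurable_logZ B β h n i).comp_aemeasurable hω.aemeasurable_env

theorem memLp_two_logZ (hB : 1 < B) (β h : ℝ) (n i : ℕ) :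
    MemLp (fun x => logZ B β h n i (fun k => ω k x)) 2 P := by
  have := hω.isProbabilityMeasure
  induction n generalizing i with
  | zero =>
    simp only [logZ_zero]
    exact ((hω.memLp_two i).const_mul β).add (memLp_const h)
  | succ n ih =>
    refine MemLp.mono' (((ih (2 * i)).norm.add (ih (2 * i + 1)).norm).sub
      (memLp_const (Real.log ((B - 1) / B)))) (hω.aemeasurable_logZ B β h _ i).aestronglyMeasurable
      (ae_of_all _ fun x => ?_)
    exact abs_logZ_succ_le hB _ n i

theorem integrable_logZ (hB : 1 < B) (β h : ℝ) (n i : ℕ) :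
    Integrable (fun x => logZ B β h n i (fun k => ω k x)) P := by
  have := hω.isProbabilityMeasure
  exact (hω.memLp_two_logZ hB β h n i).integrable (by norm_num)

theorem identDistrib_blockEnv (n j : ℕ) :
    IdentDistrib (fun x => blockEnv n j (fun k => ω k x)) (fun x => blockEnv n 0 (fun k => ω k x))
      P P where
  aemeasurable_fst := (measurable_blockEnv n j).comp_aemeasurable hω.aemeasurable_env
  aemeasurable_snd := (measurable_blockEnv n 0).comp_aemeasurable hω.aemeasurable_env
  map_eq := hω.map_blockEnv n j

theorem identDistrib_logZ (B β h : ℝ) (n j : ℕ) :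
    IdentDistrib (fun x => logZ B β h n j (fun k => ω k x))
      (fun x => logZ B β h n 0 (fun k => ω k x)) P P := by
  have h1 := (hω.identDistrib_blockEnv n j).comp (measurable_logZ B β h n 0)
  simpa only [Function.comp_def, logZ_blockEnv] using h1

/-- The plain bound 2 cov ≤ 2 Var would give the recursion the factor 4, just too much. Instead the
second half is replaced by a copy independent of the first; the Lipschitz bound in `h` controls the
error, whose variance is small as κ < 1/2. -/
theorem two_mul_covariance_logZ_le (hB : 1 < B) (hκ : 0 ≤ κ) (hκ2 : κ < 1 / 2) (β h : ℝ) (n : ℕ) :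
    2 * cov[fun x => logZ B β h n 0 (fun k => ω k x), fun x => logZ B β h n 1 (fun k => ω k x); P] ≤
      Var[fun x => logZ B β h n 0 (fun k => ω k x); P] + β ^ 2 * 2 ^ n := by
  have := hω.isProbabilityMeasure
  set c := κ ^ (n + 1) / avgVar κ n
  set A : Ω → ℝ := fun x => blockAvg n 0 (fun k => ω k x)
  set X : Ω → ℝ := fun x => logZ B β h n 0 (fun k => ω k x)
  set X' : Ω → ℝ := fun x => logZ B β h n 1 (fun k => ω k x)
  -- The second block with its regression on the first removed: independent of `X`, and equal to
  -- `X'` at a shifted value of `h`.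
  let T : Ω → ℝ := fun x => logZ B β h n 0 fun i => blockEnv n 1 (fun k => ω k x) i - c * A x
  have hA : MemLp A 2 P := hω.memLp_two_blockAvg n 0
  have hX : MemLp X 2 P := hω.memLp_two_logZ hB β h n 0
  have hX' : MemLp X' 2 P := hω.memLp_two_logZ hB β h n 1
  have hTX : IndepFun X T P := by
    have h1 := (hω.indepFun_blockEnv_zero_one hκ n).comp (measurable_logZ B β h n 0)
      (measurable_logZ B β h n 0)
    simpa only [Function.comp_def, logZ_blockEnv] using h1
  have hY : ∀ x, |(X' - T) x| ≤ 2 ^ n * |β * (c * A x)| := by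
    intro x
    have h1 : T x = logZ B β (h + β * (-(c * A x))) n 1 (fun k => ω k x) := by
      rw [← logZ_blockEnv, ← logZ_add_const]; rfl
    have h2 := abs_logZ_sub_le (β := β) hB (h + β * (-(c * A x))) (h := h) (fun k => ω k x) n 1
    rw [← h1, abs_sub_comm] at h2
    refine h2.trans (le_of_eq ?_)
    rw [add_sub_cancel_left, mul_neg, abs_neg]
  have hTm : AEStronglyMeasurable T P := by
    refine AEMeasurable.aestronglyMeasurable ?_
    refine (measurable_logZ B β h n 0).comp_aemeasurable (aemeasurable_pi_lambda _ fun i => ?_)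
    exact (hω.aemeasurable _).sub (hA.aestronglyMeasurable.aemeasurable.const_mul _)
  have hYm : MemLp (X' - T) 2 P :=
    MemLp.mono' (((hA.const_mul c).const_mul β).norm.const_mul (2 ^ n))
      (hX'.aestronglyMeasurable.sub hTm) (ae_of_all _ hY)
  have hT : MemLp T 2 P := by simpa using hX'.sub hYm
  have hcov : cov[X, X'; P] = cov[X, X' - T; P] := by
    rw [covariance_sub_right hX hX' hT, hTX.covariance_eq_zero hX hT, sub_zero]
  have hAv : ∫ x, A x ^ 2 ∂P = avgVar κ n := by
    have h1 := hω.cov_blockAvg_blockAvg n 0 0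
    rw [if_pos rfl, covariance_self hA.aestronglyMeasurable.aemeasurable, variance_eq_sub hA,
      hω.mean_blockAvg] at h1
    simpa using h1
  have hvar : Var[X' - T; P] ≤ β ^ 2 * 2 ^ n := by
    calc Var[X' - T; P] ≤ ∫ x, ((X' - T) ^ 2) x ∂P :=
          variance_le_expectation_sq hYm.aestronglyMeasurable
      _ ≤ ∫ x, (2 ^ n * (β * c)) ^ 2 * A x ^ 2 ∂P := by
          refine integral_mono hYm.integrable_sq (hA.integrable_sq.const_mul _) fun x => ?_
          have h1 := pow_le_pow_left₀ (abs_nonneg _) (hY x) 2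
          rw [sq_abs, mul_pow, sq_abs] at h1
          refine h1.trans (le_of_eq ?_)
          ring
      _ = β ^ 2 * (((2 * κ) ^ n) ^ 2 * κ ^ 2 * (avgVar κ n)⁻¹) := by
          rw [integral_const_mul, hAv]
          have := (avgVar_pos hκ n).ne'
          simp only [c]
          field_simp
          ring
      _ ≤ β ^ 2 * (1 ^ 2 * 1 ^ 2 * 2 ^ n) := by
          have h1 : (2 * κ) ^ n ≤ 1 := pow_le_one₀ (by linarith) (by linarith)
          have h2 : (avgVar κ n)⁻¹ ≤ 2 ^ n := by
            rw [inv_le_comm₀ (avgVar_pos hκ n) (by positivity)]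
            exact inv_two_pow_le_avgVar hκ n
          have h3 := (avgVar_pos hκ n).le
          gcongr
          linarith
      _ = β ^ 2 * 2 ^ n := by ring
  have := two_mul_covariance_le hX hYm
  rw [hcov]
  linarith

/-- Two equal variances and the covariance bound give 3 Var, and 11/10 · 3 = 33/10. -/
theorem variance_logZ_succ_succ_le (hB : 1 < B) (hκ : 0 ≤ κ) (hκ2 : κ < 1 / 2) (β h : ℝ) (n : ℕ) :
    Var[fun x => logZ B β h (n + 2) 0 (fun k => ω k x); P] ≤
      33 / 10 * Var[fun x => logZ B β h (n + 1) 0 (fun k => ω k x); P] +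
        (11 / 10 * β ^ 2 + 11 * (Real.log B + Real.log (1 + B ^ 2 / (B - 1))) ^ 2) * 2 ^ (n + 1) := by
  have := hω.isProbabilityMeasure
  set C := Real.log B + Real.log (1 + B ^ 2 / (B - 1))
  set Z : Ω → ℝ := fun x => logZ B β h (n + 2) 0 (fun k => ω k x)
  set X : Ω → ℝ := fun x => logZ B β h (n + 1) 0 (fun k => ω k x)
  set X' : Ω → ℝ := fun x => logZ B β h (n + 1) 1 (fun k => ω k x)
  have hZ : MemLp Z 2 P := hω.memLp_two_logZ hB β h _ 0
  have hX : MemLp X 2 P := hω.memLp_two_logZ hB β h _ 0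
  have hX' : MemLp X' 2 P := hω.memLp_two_logZ hB β h _ 1
  have he : MemLp (Z - (X + X')) 2 P := hZ.sub (hX.add hX')
  have heC : ∀ x, |(Z - (X + X')) x| ≤ C := fun x => abs_logZ_succ_succ_sub_le hB _ n 0
  have hvare : Var[Z - (X + X'); P] ≤ C ^ 2 := by
    calc Var[Z - (X + X'); P] ≤ ∫ x, ((Z - (X + X')) ^ 2) x ∂P :=
          variance_le_expectation_sq he.aestronglyMeasurable
      _ ≤ ∫ x, C ^ 2 ∂P := by
          refine integral_mono he.integrable_sq (integrable_const _) fun x => ?_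
          exact sq_le_sq' (abs_le.1 (heC x)).1 (abs_le.1 (heC x)).2
      _ = C ^ 2 := by simp
  have h1 := variance_add_le (hX.add hX') he
  rw [add_sub_cancel, variance_add hX hX'] at h1
  have h2 := hω.two_mul_covariance_logZ_le hB hκ hκ2 β h (n + 1)
  have h3 : Var[X'; P] = Var[X; P] := (hω.identDistrib_logZ B β h (n + 1) 1).variance_eq
  have h4 : C ^ 2 ≤ C ^ 2 * 2 ^ (n + 1) :=
    le_mul_of_one_le_right (sq_nonneg C) (one_le_pow₀ (by norm_num))
  linarith

theorem exists_variance_logZ_le (hB : 1 < B) (hκ : 0 ≤ κ) (hκ2 : κ < 1 / 2) (β h : ℝ) :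
    ∃ D, ∀ n, Var[fun x => logZ B β h (n + 1) 0 (fun k => ω k x); P] ≤ D * (7 / 2) ^ n := by
  set C := 11 / 10 * β ^ 2 + 11 * (Real.log B + Real.log (1 + B ^ 2 / (B - 1))) ^ 2
  have hC : 0 ≤ C := by positivity
  -- Taking D ≥ 10C makes the inhomogeneous term at most 2/10 · D(7/2)^n, and 33/10 + 2/10 = 7/2.
  refine ⟨max (Var[fun x => logZ B β h 1 0 (fun k => ω k x); P]) (10 * C), fun n => ?_⟩
  set D := max (Var[fun x => logZ B β h 1 0 (fun k => ω k x); P]) (10 * C)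
  induction n with
  | zero =>
    rw [pow_zero, mul_one]
    exact le_max_left _ _
  | succ n ih =>
    refine (hω.variance_logZ_succ_succ_le hB hκ hκ2 β h n).trans ?_
    have h1 : C * 2 ^ (n + 1) ≤ D / 10 * (2 * (7 / 2) ^ n) := by
      rw [pow_succ' (2 : ℝ)]
      have h2 : (2 : ℝ) ^ n ≤ (7 / 2) ^ n := pow_le_pow_left₀ (by norm_num) (by norm_num) n
      have h3 : C ≤ D / 10 := by
        have : 10 * C ≤ D := le_max_right _ _
        linarith
      gcongr
    change _ + C * 2 ^ (n + 1) ≤ _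
    rw [pow_succ (7 / 2 : ℝ)]
    linarith

theorem ae_tendsto_logZ_sub_integral (hB : 1 < B) (hκ : 0 ≤ κ) (hκ2 : κ < 1 / 2) (β h : ℝ) :
    ∀ᵐ x ∂P, Tendsto (fun n : ℕ => logZ B β h n 0 (fun k => ω k x) / 2 ^ n -
      (∫ y, logZ B β h n 0 (fun k => ω k y) ∂P) / 2 ^ n) atTop (𝓝 0) := by
  have := hω.isProbabilityMeasure
  obtain ⟨D, hD⟩ := hω.exists_variance_logZ_le hB hκ hκ2 β h
  have hv : ∀ n : ℕ, Var[fun x => logZ B β h n 0 (fun k => ω k x) / 2 ^ n; P] =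
      Var[fun x => logZ B β h n 0 (fun k => ω k x); P] / 4 ^ n := fun n => by
    simp_rw [div_eq_mul_inv, mul_comm _ ((2 : ℝ) ^ n)⁻¹]
    rw [variance_const_mul, inv_pow, ← pow_mul, mul_comm n 2, pow_mul, mul_comm]
    norm_num
  have hs : Summable fun n : ℕ => Var[fun x => logZ B β h n 0 (fun k => ω k x) / 2 ^ n; P] := by
    refine (summable_nat_add_iff 1).1 (Summable.of_nonneg_of_le (fun n => variance_nonneg _ _)
      (fun n => ?_) ((summable_geometric_of_lt_one (r := 7 / 8) (by norm_num)
        (by norm_num)).mul_left (D / 4)))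
    rw [hv]
    calc _ ≤ D * (7 / 2) ^ n / 4 ^ (n + 1) := by gcongr; exact hD n
      _ = D / 4 * (7 / 8) ^ n := by
        rw [show (7 / 8 : ℝ) = (7 / 2) / 4 by norm_num, div_pow (7 / 2 : ℝ) 4]
        ring
  have h1 := ae_tendsto_sub_integral_of_summable_variance
    (fun n => ((hω.memLp_two_logZ hB β h n 0).mul_const (2 ^ n)⁻¹)) (by simpa [div_eq_mul_inv] using hs)
  simp only [← div_eq_mul_inv, integral_div] at h1
  exact h1

end IsHierarchicalDisorder

end Variance

/-! ### Expansion over contact sets -/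

section Expansion

/-- The partition function is a convex combination of the Boltzmann weights of finite subsets of
the block. -/
theorem exists_partitionFunction_eq_sum {B : ℝ} (hB : 1 < B) (n i : ℕ) :
    ∃ (ι : Type) (_ : Fintype ι) (c : ι → ℝ) (S : ι → Finset ℕ),
      (∀ t, 0 ≤ c t) ∧ ∑ t, c t = 1 ∧ (∀ t, ∀ k ∈ S t, k / 2 ^ n = i) ∧
      ∀ (β h : ℝ) (w : ℕ → ℝ),
        partitionFunction B β h w n i = ∑ t, c t * Real.exp (∑ k ∈ S t, (β * w k + h)) := by
  induction n generalizing i with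
  | zero =>
    exact ⟨Unit, inferInstance, fun _ => 1, fun _ => {i}, by simp, by simp, by simp,
      by simp [partitionFunction]⟩
  | succ n ih =>
    obtain ⟨ι₁, _, c₁, S₁, hc₁, hs₁, hS₁, hZ₁⟩ := ih (2 * i)
    obtain ⟨ι₂, _, c₂, S₂, hc₂, hs₂, hS₂, hZ₂⟩ := ih (2 * i + 1)
    have hB0 : B ≠ 0 := by linarith
    -- `none` is the term (B - 1)/B, with empty contact set; `some` pairs a choice in each half.
    refine ⟨Option (ι₁ × ι₂), inferInstance,
      fun t => t.elim ((B - 1) / B) fun t => c₁ t.1 * c₂ t.2 / B,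
      fun t => t.elim ∅ fun t => S₁ t.1 ∪ S₂ t.2, ?_, ?_, ?_, ?_⟩
    · rintro (_ | t)
      · exact div_nonneg (by linarith) (by linarith)
      · exact div_nonneg (mul_nonneg (hc₁ _) (hc₂ _)) (by linarith)
    · simp only [Fintype.sum_option, Option.elim]
      rw [← Finset.sum_div, Fintype.sum_prod_type, ← Finset.sum_mul_sum, hs₁, hs₂]
      field_simp
      ring
    · rintro (_ | t) k hk
      · simp at hk
      · rw [pow_succ, ← Nat.div_div_eq_div_mul]
        rcases Finset.mem_union.1 hk with hk | hk
        · rw [hS₁ _ k hk]; omega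
        · rw [hS₂ _ k hk]; omega
    · intro β h w
      have hd : ∀ t₁ t₂, Disjoint (S₁ t₁) (S₂ t₂) := fun t₁ t₂ =>
        Finset.disjoint_left.2 fun k h1 h2 => by
          have h3 := hS₁ _ k h1
          have h4 := hS₂ _ k h2
          omega
      have he : ∀ t : ι₁ × ι₂, c₁ t.1 * c₂ t.2 / B *
          Real.exp (∑ k ∈ S₁ t.1 ∪ S₂ t.2, (β * w k + h)) =
          (c₁ t.1 * Real.exp (∑ k ∈ S₁ t.1, (β * w k + h))) *
            (c₂ t.2 * Real.exp (∑ k ∈ S₂ t.2, (β * w k + h))) / B := fun t => by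
        rw [Finset.sum_union (hd _ _), Real.exp_add]; ring
      simp only [Fintype.sum_option, Option.elim, partitionFunction, Finset.sum_empty,
        Real.exp_zero, he]
      rw [← Finset.sum_div, Fintype.sum_prod_type]
      dsimp only
      rw [← Finset.sum_mul_sum, hZ₁, hZ₂]
      ring

end Expansion

/-! ### Free energy and critical point -/

variable {Ω : Type*} [MeasurableSpace Ω] {P : Measure Ω} {ω : ℕ → Ω → ℝ} {κ B : ℝ}

theorem finiteFreeEnergy_eq (B β h : ℝ) (n : ℕ) :
    finiteFreeEnergy B ω P β h n = (∫ x, logZ B β h n 0 (fun k => ω k x) ∂P) / 2 ^ n := rfl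

namespace IsHierarchicalDisorder

variable (hω : IsHierarchicalDisorder κ ω P)
include hω

theorem mean_linComb (c : ℕ →₀ ℝ) : ∫ x, (c.sum fun i a => a * ω i x) ∂P = 0 := by
  have := hω.isProbabilityMeasure
  simp only [Finsupp.sum]
  rw [integral_finsetSum _ fun i _ => ((hω.memLp_two i).integrable (by norm_num)).const_mul _]
  simp [integral_const_mul, hω.mean_eq_zero]

/-- The exponential moments of a linear combination of the disorder. -/
theorem hasExpMoment_linComb (c : ℕ →₀ ℝ) :
    Integrable (fun x => Real.exp (c.sum fun i a => a * ω i x)) P ∧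
      ∫ x, Real.exp (c.sum fun i a => a * ω i x) ∂P =
        Real.exp (Var[fun x => c.sum fun i a => a * ω i x; P] / 2) := by
  have hG := hω.hasGaussianLaw_linComb c
  have hmap := hG.map_eq_gaussianReal
  rw [hω.mean_linComb] at hmap
  constructor
  · have h1 := integrable_exp_mul_gaussianReal (μ := 0)
      (v := Var[fun x => c.sum fun i a => a * ω i x; P].toNNReal) 1
    rw [← hmap] at h1
    simpa [Function.comp_def] using h1.comp_aemeasurable hG.aemeasurable
  · have h1 := mgf_gaussianReal hmap 1
    simpa [mgf, Real.coe_toNNReal _ (variance_nonneg _ _)] using h1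

/-- Each row sum over S is at most the row sum over a full block containing S, as the covariances
are nonnegative. -/
theorem variance_sum_le (hκ : 0 ≤ κ) (hκ2 : κ < 1 / 2) (S : Finset ℕ) :
    Var[fun x => ∑ i ∈ S, ω i x; P] ≤ S.card * (1 + (1 - 2 * κ)⁻¹) := by
  have := hω.isProbabilityMeasure
  rw [variance_fun_sum' fun i _ => hω.memLp_two i, ← nsmul_eq_mul]
  refine Finset.sum_le_card_nsmul _ _ _ fun i hi => ?_
  obtain ⟨N, hN⟩ : ∃ N, S ⊆ Finset.range (2 ^ N) := by
    obtain ⟨N, hN⟩ := S.exists_nat_subset_range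
    exact ⟨N, hN.trans (Finset.range_subset_range.2 Nat.lt_two_pow_self.le)⟩
  refine le_trans ?_ (rowSum_le hκ hκ2 N)
  rw [← sum_pow_treeDist κ (Finset.mem_range.1 (hN hi))]
  simp only [hω.cov_eq]
  exact Finset.sum_le_sum_of_subset_of_nonneg hN fun _ _ _ => by positivity

/-- The annealed bound. -/
theorem integral_logZ_nonpos (hB : 1 < B) (hκ : 0 ≤ κ) (hκ2 : κ < 1 / 2) {β h : ℝ}
    (hh : h ≤ -(β ^ 2 * (1 + (1 - 2 * κ)⁻¹) / 2)) (n : ℕ) :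
    ∫ x, logZ B β h n 0 (fun k => ω k x) ∂P ≤ 0 := by
  have := hω.isProbabilityMeasure
  obtain ⟨ι, _, c, S, hc, hs, -, hZ⟩ := exists_partitionFunction_eq_sum hB n 0
  have hsum : ∀ (t) (x), ∑ k ∈ S t, (β * ω k x + h) =
      (β • ∑ k ∈ S t, Finsupp.single k (1 : ℝ)).sum (fun i a => a * ω i x) + (S t).card * h := by
    intro t x
    rw [linComb_smul, ← Finsupp.sum_finsetSum_index (by simp) (by intros; ring),
      Finset.sum_add_distrib, Finset.mul_sum]
    simp
  have hvar : ∀ t, Var[fun x => (β • ∑ k ∈ S t, Finsupp.single k (1 : ℝ)).sum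
      fun i a => a * ω i x; P] ≤ β ^ 2 * ((S t).card * (1 + (1 - 2 * κ)⁻¹)) := by
    intro t
    have h1 : (fun x => (β • ∑ k ∈ S t, Finsupp.single k (1 : ℝ)).sum fun i a => a * ω i x) =
        fun x => β * ∑ i ∈ S t, ω i x := by
      ext x
      rw [linComb_smul, ← Finsupp.sum_finsetSum_index (by simp) (by intros; ring)]
      simp
    rw [h1, variance_const_mul]
    gcongr
    exact hω.variance_sum_le hκ hκ2 (S t)
  have hint : ∀ t, Integrable (fun x => Real.exp (∑ k ∈ S t, (β * ω k x + h))) P ∧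
      ∫ x, Real.exp (∑ k ∈ S t, (β * ω k x + h)) ∂P ≤ 1 := by
    intro t
    simp only [hsum, Real.exp_add]
    have h1 := hω.hasExpMoment_linComb (β • ∑ k ∈ S t, Finsupp.single k (1 : ℝ))
    refine ⟨h1.1.mul_const _, ?_⟩
    rw [integral_mul_const, h1.2, ← Real.exp_add, Real.exp_le_one_iff]
    have h2 := mul_le_mul_of_nonneg_left hh (Nat.cast_nonneg (α := ℝ) (S t).card)
    linarith [hvar t]
  have hZint : Integrable (fun x => partitionFunction B β h (fun k => ω k x) n 0) P := by
    simp only [hZ]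
    exact integrable_finsetSum _ fun t _ => (hint t).1.const_mul _
  have hZle : ∫ x, partitionFunction B β h (fun k => ω k x) n 0 ∂P ≤ 1 := by
    simp only [hZ]
    rw [integral_finsetSum _ fun t _ => (hint t).1.const_mul _, ← hs]
    refine Finset.sum_le_sum fun t _ => ?_
    rw [integral_const_mul]
    exact mul_le_of_le_one_right (hc t) (hint t).2
  -- Jensen in the form log z ≤ z - 1, which suffices because E[Z_n] ≤ 1.
  calc _ ≤ ∫ x, (partitionFunction B β h (fun k => ω k x) n 0 - 1) ∂P := by
        refine integral_mono (hω.integrable_logZ hB β h n 0) (hZint.sub (integrable_const 1))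
          fun x => ?_
        exact Real.log_le_sub_one_of_pos (partitionFunction_pos hB ..)
    _ ≤ 0 := by
        rw [integral_sub hZint (integrable_const 1)]
        simpa using hZle

theorem abs_integral_logZ_succ_sub_le (hB : 1 < B) (β h : ℝ) (n : ℕ) :
    |∫ x, logZ B β h (n + 2) 0 (fun k => ω k x) ∂P -
      2 * ∫ x, logZ B β h (n + 1) 0 (fun k => ω k x) ∂P| ≤
        Real.log B + Real.log (1 + B ^ 2 / (B - 1)) := by
  have := hω.isProbabilityMeasure
  have i1 := hω.integrable_logZ hB β h (n + 1) 0
  have i2 := hω.integrable_logZ hB β h (n + 1) 1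
  have h2 : ∫ x, logZ B β h (n + 1) 1 (fun k => ω k x) ∂P =
    ∫ x, logZ B β h (n + 1) 0 (fun k => ω k x) ∂P := (hω.identDistrib_logZ B β h (n + 1) 1).integral_eq
  have i12 : Integrable (fun x => logZ B β h (n + 1) 0 (fun k => ω k x) +
    logZ B β h (n + 1) 1 (fun k => ω k x)) P := i1.add i2
  have h3 : ∫ x, (logZ B β h (n + 1) 0 (fun k => ω k x) + logZ B β h (n + 1) 1 (fun k => ω k x)) ∂P
      = 2 * ∫ x, logZ B β h (n + 1) 0 (fun k => ω k x) ∂P := by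
    rw [integral_add i1 i2, h2, two_mul]
  rw [← h3, ← integral_sub (hω.integrable_logZ hB β h (n + 2) 0) i12, ← Real.norm_eq_abs]
  refine (norm_integral_le_of_norm_le_const
    (C := Real.log B + Real.log (1 + B ^ 2 / (B - 1))) (ae_of_all _ fun x => ?_)).trans_eq ?_
  · exact abs_logZ_succ_succ_sub_le hB (fun k => ω k x) n 0
  · simp

theorem two_mul_integral_logZ_sub_le (hB : 1 < B) (β h : ℝ) (n : ℕ) :
    2 * ∫ x, logZ B β h n 0 (fun k => ω k x) ∂P - Real.log B ≤
      ∫ x, logZ B β h (n + 1) 0 (fun k => ω k x) ∂P := by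
  have := hω.isProbabilityMeasure
  have i1 := hω.integrable_logZ hB β h n 0
  have i2 := hω.integrable_logZ hB β h n 1
  have h2 : ∫ x, logZ B β h n 1 (fun k => ω k x) ∂P =
    ∫ x, logZ B β h n 0 (fun k => ω k x) ∂P := (hω.identDistrib_logZ B β h n 1).integral_eq
  have i12 : Integrable (fun x => logZ B β h n 0 (fun k => ω k x) +
    logZ B β h n 1 (fun k => ω k x)) P := i1.add i2
  have h3 : ∫ x, (logZ B β h n 0 (fun k => ω k x) + logZ B β h n 1 (fun k => ω k x) - Real.log B) ∂P
      = 2 * ∫ x, logZ B β h n 0 (fun k => ω k x) ∂P - Real.log B := by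
    rw [integral_sub i12 (integrable_const _), integral_add i1 i2, h2, two_mul]
    simp
  rw [← h3]
  exact integral_mono (i12.sub (integrable_const _)) (hω.integrable_logZ hB β h (n + 1) 0)
    fun x => add_sub_log_le_logZ_succ hB (fun k => ω k x) n 0

/-- Merging two halves changes the mean of log Z by a bounded amount, so increments after division
by 2^n are geometric. This makes `limUnder` a genuine limit. -/
theorem tendsto_finiteFreeEnergy (hB : 1 < B) (β h : ℝ) :
    Tendsto (finiteFreeEnergy B ω P β h) atTop (𝓝 (freeEnergy B ω P β h)) := by
  refine tendsto_nhds_limUnder ?_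
  have hc : CauchySeq fun n => finiteFreeEnergy B ω P β h (n + 1) := by
    refine cauchySeq_of_le_geometric (1 / 2)
      ((Real.log B + Real.log (1 + B ^ 2 / (B - 1))) / 4) (by norm_num) fun n => ?_
    rw [dist_comm, Real.dist_eq, finiteFreeEnergy_eq, finiteFreeEnergy_eq]
    have h1 := hω.abs_integral_logZ_succ_sub_le hB β h n
    calc _ = |∫ x, logZ B β h (n + 2) 0 (fun k => ω k x) ∂P -
        2 * ∫ x, logZ B β h (n + 1) 0 (fun k => ω k x) ∂P| * (1 / 4 * (1 / 2) ^ n) := by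
          rw [← abs_of_nonneg (a := (1 / 4 * (1 / 2) ^ n : ℝ)) (by positivity), ← abs_mul]
          congr 1
          rw [pow_succ, pow_succ, one_div_pow]
          field_simp
          ring
      _ ≤ _ := by
          refine (mul_le_mul_of_nonneg_right h1 (by positivity)).trans_eq ?_
          ring
  obtain ⟨F, hF⟩ := cauchySeq_tendsto_of_complete hc
  exact ⟨F, (tendsto_add_atTop_iff_nat 1).1 hF⟩

theorem ae_tendsto_logPartitionFunction (hB : 1 < B) (hκ : 0 ≤ κ) (hκ2 : κ < 1 / 2) (β h : ℝ) :
    ∀ᵐ x ∂P, Tendsto (fun n : ℕ => logPartitionFunction B β h ω n x / 2 ^ n) atTop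
      (𝓝 (freeEnergy B ω P β h)) := by
  filter_upwards [hω.ae_tendsto_logZ_sub_integral hB hκ hκ2 β h] with x hx
  have h1 := hx.add (hω.tendsto_finiteFreeEnergy hB β h)
  rw [zero_add] at h1
  refine h1.congr fun n => ?_
  rw [finiteFreeEnergy_eq, sub_add_cancel]
  rfl

theorem freeEnergy_nonneg (hB : 1 < B) (β h : ℝ) : 0 ≤ freeEnergy B ω P β h := by
  have := hω.isProbabilityMeasure
  have h1 := (tendsto_add_atTop_iff_nat 1).2 (hω.tendsto_finiteFreeEnergy hB β h)
  have h2 : Tendsto (fun n : ℕ => Real.log ((B - 1) / B) / 2 ^ (n + 1)) atTop (𝓝 0) :=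
    Tendsto.comp (g := fun n : ℕ => Real.log ((B - 1) / B) / 2 ^ n)
      (tendsto_const_nhds.div_atTop (tendsto_pow_atTop_atTop_of_one_lt one_lt_two))
      (tendsto_add_atTop_nat 1)
  refine le_of_tendsto_of_tendsto' h2 h1 fun n => ?_
  rw [finiteFreeEnergy_eq]
  refine div_le_div_of_nonneg_right ?_ (by positivity)
  calc Real.log ((B - 1) / B) = ∫ _, Real.log ((B - 1) / B) ∂P := by simp
    _ ≤ _ := integral_mono (integrable_const _) (hω.integrable_logZ hB β h _ 0)
      fun x => le_logZ_succ hB _ n 0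

theorem freeEnergy_mono (hB : 1 < B) (β : ℝ) : Monotone (freeEnergy B ω P β) := by
  intro h h' hh
  refine le_of_tendsto_of_tendsto' (hω.tendsto_finiteFreeEnergy hB β h)
    (hω.tendsto_finiteFreeEnergy hB β h') fun n => ?_
  rw [finiteFreeEnergy_eq, finiteFreeEnergy_eq]
  refine div_le_div_of_nonneg_right ?_ (by positivity)
  exact integral_mono (hω.integrable_logZ hB β h n 0) (hω.integrable_logZ hB β h' n 0)
    fun x => logZ_mono hB hh _ n 0

theorem freeEnergy_le_add (hB : 1 < B) (β : ℝ) {h h' : ℝ} (hh : h ≤ h') :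
    freeEnergy B ω P β h' ≤ freeEnergy B ω P β h + (h' - h) := by
  have := hω.isProbabilityMeasure
  refine le_of_tendsto_of_tendsto' (hω.tendsto_finiteFreeEnergy hB β h')
    ((hω.tendsto_finiteFreeEnergy hB β h).add_const (h' - h)) fun n => ?_
  rw [finiteFreeEnergy_eq, finiteFreeEnergy_eq, div_add' _ _ _ (by positivity)]
  refine div_le_div_of_nonneg_right ?_ (by positivity)
  have i1 := hω.integrable_logZ hB β h n 0
  calc _ ≤ ∫ x, (logZ B β h n 0 (fun k => ω k x) + 2 ^ n * (h' - h)) ∂P :=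
        integral_mono (hω.integrable_logZ hB β h' n 0) (i1.add (integrable_const _))
          fun x => logZ_le_add hB hh _ n 0
    _ = _ := by
        rw [integral_add i1 (integrable_const _)]
        simp [mul_comm]

/-- By superadditivity the left side increases in n to the free energy. Where F = 0 it yields E[log
Z_n] ≤ log B at every n. -/
theorem integral_logZ_sub_log_div_le (hB : 1 < B) (β h : ℝ) (n : ℕ) :
    (∫ x, logZ B β h n 0 (fun k => ω k x) ∂P - Real.log B) / 2 ^ n ≤ freeEnergy B ω P β h := by
  have hm : Monotone fun n : ℕ =>
      (∫ x, logZ B β h n 0 (fun k => ω k x) ∂P - Real.log B) / 2 ^ n := by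
    refine monotone_nat_of_le_succ fun n => ?_
    rw [div_le_div_iff₀ (by positivity) (by positivity), pow_succ]
    have h1 := hω.two_mul_integral_logZ_sub_le hB β h n
    have h2 : (0 : ℝ) < 2 ^ n := by positivity
    nlinarith
  have ht : Tendsto (fun n : ℕ =>
      (∫ x, logZ B β h n 0 (fun k => ω k x) ∂P - Real.log B) / 2 ^ n) atTop
      (𝓝 (freeEnergy B ω P β h)) := by
    have h1 := (hω.tendsto_finiteFreeEnergy hB β h).sub
      ((tendsto_const_nhds (x := Real.log B)).div_atTop
        (tendsto_pow_atTop_atTop_of_one_lt one_lt_two))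
    rw [sub_zero] at h1
    refine h1.congr fun n => ?_
    rw [finiteFreeEnergy_eq, sub_div]
  exact hm.ge_of_tendsto ht n

theorem sub_log_le_freeEnergy (hB : 1 < B) (β h : ℝ) :
    h - Real.log B ≤ freeEnergy B ω P β h := by
  have := hω.isProbabilityMeasure
  have h1 := hω.integral_logZ_sub_log_div_le hB β h 0
  simp only [logZ_zero] at h1
  rw [integral_add (((hω.memLp_two 0).integrable (by norm_num)).const_mul β) (integrable_const h),
    integral_const_mul, hω.mean_eq_zero] at h1
  simpa using h1

theorem freeEnergy_nonpos (hB : 1 < B) (hκ : 0 ≤ κ) (hκ2 : κ < 1 / 2) {β h : ℝ}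
    (hh : h ≤ -(β ^ 2 * (1 + (1 - 2 * κ)⁻¹) / 2)) : freeEnergy B ω P β h ≤ 0 := by
  refine le_of_tendsto' (hω.tendsto_finiteFreeEnergy hB β h) fun n => ?_
  rw [finiteFreeEnergy_eq]
  exact div_nonpos_of_nonpos_of_nonneg (hω.integral_logZ_nonpos hB hκ hκ2 hh n) (by positivity)

theorem freeEnergy_pos_of_criticalPoint_lt (hB : 1 < B) {β h : ℝ}
    (hh : criticalPoint B ω P β < h) : 0 < freeEnergy B ω P β h := by
  have hne : {h : ℝ | 0 < freeEnergy B ω P β h}.Nonempty :=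
    ⟨Real.log B + 1, lt_of_lt_of_le (by linarith) (hω.sub_log_le_freeEnergy hB β _)⟩
  obtain ⟨h', hh', hlt⟩ := exists_lt_of_csInf_lt hne hh
  exact lt_of_lt_of_le hh' (hω.freeEnergy_mono hB β hlt.le)

/-- The annealed bound makes the set bounded below, so its `sInf` is a true infimum; the Lipschitz
bound covers h = h_c. -/
theorem freeEnergy_eq_zero_of_le_criticalPoint (hB : 1 < B) (hκ : 0 ≤ κ) (hκ2 : κ < 1 / 2)
    {β h : ℝ} (hh : h ≤ criticalPoint B ω P β) : freeEnergy B ω P β h = 0 := by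
  have hbdd : BddBelow {h : ℝ | 0 < freeEnergy B ω P β h} := by
    refine ⟨-(β ^ 2 * (1 + (1 - 2 * κ)⁻¹) / 2), fun h hh => ?_⟩
    by_contra hcon
    exact absurd hh (not_lt.2 (hω.freeEnergy_nonpos hB hκ hκ2 (not_le.1 hcon).le))
  refine le_antisymm (le_of_forall_pos_le_add fun ε hε => ?_) (hω.freeEnergy_nonneg hB β h)
  have h1 := hω.freeEnergy_le_add hB β (show h - ε ≤ h by linarith)
  have h2 : ¬ 0 < freeEnergy B ω P β (h - ε) := fun hpos => by
    have h3 := csInf_le hbdd (show h - ε ∈ {h : ℝ | 0 < freeEnergy B ω P β h} from hpos)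
    change criticalPoint B ω P β ≤ h - ε at h3
    linarith
  linarith [not_lt.1 h2]

end IsHierarchicalDisorder

/-! ### Shifting the disorder and finding good blocks -/

open scoped ENNReal NNReal

/-- The Cameron–Martin formula for a real Gaussian variable. -/
theorem lintegral_gaussianReal_add {v : ℝ≥0} (hv : v ≠ 0) (t : ℝ) {f : ℝ → ℝ≥0∞}
    (hf : Measurable f) :
    ∫⁻ a, f (a + t) ∂gaussianReal 0 v =
      ∫⁻ a, ENNReal.ofReal (Real.exp (t / v * a - t ^ 2 / v / 2)) * f a ∂gaussianReal 0 v := by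
  have h1 : ∫⁻ a, f (a + t) ∂gaussianReal 0 v = ∫⁻ a, f a ∂gaussianReal t v := by
    rw [← lintegral_map hf (by fun_prop), gaussianReal_map_add_const, zero_add]
  rw [h1, gaussianReal_of_var_ne_zero _ hv, gaussianReal_of_var_ne_zero _ hv,
    lintegral_withDensity_eq_lintegral_mul _ (measurable_gaussianPDF _ _) hf,
    lintegral_withDensity_eq_lintegral_mul _ (measurable_gaussianPDF _ _) (by fun_prop)]
  refine lintegral_congr fun a => ?_
  have hv' : (v : ℝ) ≠ 0 := by exact_mod_cast hv
  simp only [Pi.mul_apply, ← mul_assoc]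
  congr 1
  rw [gaussianPDF, gaussianPDF, ← ENNReal.ofReal_mul (gaussianPDFReal_nonneg _ _ _)]
  congr 1
  rw [gaussianPDFReal, gaussianPDFReal, mul_assoc _ (Real.exp _) (Real.exp _), ← Real.exp_add]
  congr 2
  field_simp
  ring

variable {Ω : Type*} [MeasurableSpace Ω] {P : Measure Ω} {ω : ℕ → Ω → ℝ} {κ B : ℝ}

/-- The logarithm of the density that shifts the disorder in the `j`-th block by `t`. -/
noncomputable def tilt (κ t : ℝ) (n j : ℕ) (w : ℕ → ℝ) : ℝ :=
  t / avgVar κ n * blockAvg n j w - t ^ 2 / avgVar κ n / 2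

theorem tilt_eq_linComb (κ t : ℝ) (n j : ℕ) (w : ℕ → ℝ) :
    tilt κ t n j w = (((t / avgVar κ n) • avgCoeff n j).sum fun i a => a * w i) -
      t ^ 2 / avgVar κ n / 2 := by
  rw [linComb_smul, linComb_avgCoeff, tilt]

/-- Serves to truncate the total density W at the scale KM, at the price of its second moment. -/
theorem le_mul_add_sq_mul_inv {K M W : ℝ} (hK : 0 < K) (hM : 0 < M) :
    W ≤ K * M + W ^ 2 * (4 * K * M)⁻¹ := by
  have h1 : K * M + W ^ 2 * (4 * K * M)⁻¹ - W = (2 * (K * M) - W) ^ 2 * (4 * K * M)⁻¹ := by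
    field_simp
    ring
  have h2 : 0 ≤ (2 * (K * M) - W) ^ 2 * (4 * K * M)⁻¹ := by positivity
  linarith

namespace IsHierarchicalDisorder

variable (hω : IsHierarchicalDisorder κ ω P)
include hω

/-- Write the block as fluctuations plus average, which are independent: the density depends on the
average alone, so the real Cameron–Martin formula applies with the fluctuations frozen. -/
theorem lintegral_tilt (hκ : 0 ≤ κ) (t : ℝ) (n j : ℕ) {f : (ℕ → ℝ) → ℝ≥0∞} (hf : Measurable f) :
    ∫⁻ x, ENNReal.ofReal (Real.exp (tilt κ t n j fun k => ω k x)) *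
      f (blockEnv n j fun k => ω k x) ∂P =
      ∫⁻ x, f (fun i => blockEnv n j (fun k => ω k x) i + t) ∂P := by
  have := hω.isProbabilityMeasure
  have hv := avgVar_pos hκ n
  have hv0 : (avgVar κ n).toNNReal ≠ 0 := by simpa using hv
  have hvc : ((avgVar κ n).toNNReal : ℝ) = avgVar κ n := Real.coe_toNNReal _ hv.le
  let R : Ω → ℕ → ℝ := fun x i => blockEnv n j (fun k => ω k x) i - blockAvg n j (fun k => ω k x)
  let A : Ω → ℝ := fun x => blockAvg n j (fun k => ω k x)
  have hA : AEMeasurable A P := (measurable_blockAvg n j).comp_aemeasurable hω.aemeasurable_env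
  have hR : AEMeasurable R P := aemeasurable_pi_lambda _ fun i => (hω.aemeasurable _).sub hA
  have hlaw : P.map (fun x => (R x, A x)) = (P.map R).prod (gaussianReal 0 (avgVar κ n).toNNReal) := by
    rw [(indepFun_iff_map_prod_eq_prod_map_map hR hA).1 (hω.indepFun_blockEnv_sub_blockAvg n j),
      hω.map_blockAvg]
  have := Measure.isProbabilityMeasure_map hR
  have hg : Measurable fun p : (ℕ → ℝ) × ℝ => f fun i => p.1 i + p.2 := by fun_prop
  have hgt : Measurable fun p : (ℕ → ℝ) × ℝ => f fun i => p.1 i + (p.2 + t) := by fun_prop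
  have hge : Measurable fun p : (ℕ → ℝ) × ℝ =>
      ENNReal.ofReal (Real.exp (t / avgVar κ n * p.2 - t ^ 2 / avgVar κ n / 2)) *
        f fun i => p.1 i + p.2 := by fun_prop
  calc _ = ∫⁻ x, (fun p : (ℕ → ℝ) × ℝ =>
      ENNReal.ofReal (Real.exp (t / avgVar κ n * p.2 - t ^ 2 / avgVar κ n / 2)) *
        f fun i => p.1 i + p.2) (R x, A x) ∂P := by
        simp only [R, A, sub_add_cancel]; rfl
    _ = ∫⁻ x, (fun p : (ℕ → ℝ) × ℝ => f fun i => p.1 i + (p.2 + t)) (R x, A x) ∂P := by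
        rw [← lintegral_map' hge.aemeasurable (hR.prodMk hA),
          ← lintegral_map' hgt.aemeasurable (hR.prodMk hA), hlaw,
          lintegral_prod _ hge.aemeasurable, lintegral_prod _ hgt.aemeasurable]
        refine lintegral_congr fun r => ?_
        have h1 := lintegral_gaussianReal_add hv0 t (f := fun a => f fun i => r i + a) (by fun_prop)
        rw [hvc] at h1
        exact h1.symm
    _ = _ := by simp only [R, A, ← add_assoc, sub_add_cancel]

theorem integrable_exp_tilt (t : ℝ) (n j : ℕ) :
    Integrable (fun x => Real.exp (tilt κ t n j fun k => ω k x)) P := by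
  simp only [tilt_eq_linComb, Real.exp_sub]
  exact (hω.hasExpMoment_linComb _).1.div_const _

theorem integral_indicator_mul_exp_tilt (hκ : 0 ≤ κ) (t : ℝ) (n j : ℕ) {E : Set (ℕ → ℝ)}
    (hE : MeasurableSet E) :
    ∫ x, Real.exp (tilt κ t n j fun k => ω k x) *
      E.indicator (fun _ => (1 : ℝ)) (blockEnv n j fun k => ω k x) ∂P =
      P.real {x | (fun i => blockEnv n 0 (fun k => ω k x) i + t) ∈ E} := by
  have hb : ∀ j, AEMeasurable (fun x => blockEnv n j fun k => ω k x) P := fun j =>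
    (measurable_blockEnv n j).comp_aemeasurable hω.aemeasurable_env
  have hT : AEMeasurable (fun x => tilt κ t n j fun k => ω k x) P :=
    (((measurable_blockAvg n j).const_mul _).sub_const _).comp_aemeasurable hω.aemeasurable_env
  have hI : Measurable (E.indicator fun _ => (1 : ℝ)) := measurable_const.indicator hE
  have hI' : Measurable (E.indicator fun _ => (1 : ℝ≥0∞)) := measurable_const.indicator hE
  have hs : Measurable fun u : ℕ → ℝ => fun i => u i + t := by fun_prop
  have hIs : Measurable fun u : ℕ → ℝ => E.indicator (fun _ => (1 : ℝ≥0∞)) fun i => u i + t :=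
    hI'.comp hs
  rw [integral_eq_lintegral_of_nonneg_ae]
  · rw [measureReal_def]
    congr 1
    have h1 := hω.lintegral_tilt hκ t n j hI'
    have h2 : ∀ x, ENNReal.ofReal (Real.exp (tilt κ t n j fun k => ω k x) *
        E.indicator (fun _ => (1 : ℝ)) (blockEnv n j fun k => ω k x)) =
        ENNReal.ofReal (Real.exp (tilt κ t n j fun k => ω k x)) *
          E.indicator (fun _ => (1 : ℝ≥0∞)) (blockEnv n j fun k => ω k x) := fun x => by
      by_cases hx : (blockEnv n j fun k => ω k x) ∈ E <;> simp [hx]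
    simp only [h2]
    rw [h1, ← lintegral_map' (f := fun u => E.indicator (fun _ => (1 : ℝ≥0∞)) fun i => u i + t)
      hIs.aemeasurable (hb j), hω.map_blockEnv, lintegral_map' hIs.aemeasurable (hb 0)]
    have h3 : ∀ x, E.indicator (fun _ => (1 : ℝ≥0∞))
        (fun i => blockEnv n 0 (fun k => ω k x) i + t) =
        {x | (fun i => blockEnv n 0 (fun k => ω k x) i + t) ∈ E}.indicator (fun _ => 1) x :=
      fun x => rfl
    simp only [h3]
    rw [lintegral_indicator_const₀, one_mul]
    exact (hs.comp_aemeasurable (hb 0)).nullMeasurable hE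
  · exact ae_of_all _ fun x => mul_nonneg (Real.exp_pos _).le
      (Set.indicator_nonneg (fun _ _ => zero_le_one) _)
  · exact (hT.exp.mul (hI.comp_aemeasurable (hb j))).aestronglyMeasurable

/-- Each density has mean 1, so only the covariance of the two exponents survives. -/
theorem integral_exp_tilt_mul_exp_tilt (hκ : 0 ≤ κ) (t : ℝ) (n j j' : ℕ) :
    Integrable (fun x => Real.exp (tilt κ t n j fun k => ω k x) *
      Real.exp (tilt κ t n j' fun k => ω k x)) P ∧
    ∫ x, Real.exp (tilt κ t n j fun k => ω k x) * Real.exp (tilt κ t n j' fun k => ω k x) ∂P =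
      Real.exp (t ^ 2 / avgVar κ n ^ 2 *
        if j = j' then avgVar κ n else κ ^ (n + treeDist j j')) := by
  have := hω.isProbabilityMeasure
  have hv := (avgVar_pos hκ n).ne'
  have hrw : ∀ x, Real.exp (tilt κ t n j fun k => ω k x) * Real.exp (tilt κ t n j' fun k => ω k x) =
      Real.exp (((t / avgVar κ n) • (avgCoeff n j + avgCoeff n j')).sum fun i a => a * ω i x) *
        Real.exp (-(t ^ 2 / avgVar κ n)) := fun x => by
    rw [← Real.exp_add, ← Real.exp_add, linComb_smul, linComb_add, linComb_avgCoeff,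
      linComb_avgCoeff, tilt, tilt]
    ring_nf
  have h1 := hω.hasExpMoment_linComb ((t / avgVar κ n) • (avgCoeff n j + avgCoeff n j'))
  simp only [hrw]
  refine ⟨h1.1.mul_const _, ?_⟩
  have hA := hω.memLp_two_blockAvg n j
  have hA' := hω.memLp_two_blockAvg n j'
  have hvar : ∀ j, Var[fun x => blockAvg n j (fun k => ω k x); P] = avgVar κ n := fun j => by
    rw [← covariance_self (hω.memLp_two_blockAvg n j).aestronglyMeasurable.aemeasurable,
      hω.cov_blockAvg_blockAvg, if_pos rfl]
  rw [integral_mul_const, h1.2, ← Real.exp_add]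
  simp only [linComb_smul, linComb_add, linComb_avgCoeff]
  rw [variance_const_mul, variance_fun_add hA hA', hvar, hvar, hω.cov_blockAvg_blockAvg]
  congr 1
  field_simp
  ring

/-- If a block is good with probability at least `1 / 2` once its disorder is shifted by `t`, then
with probability bounded below there is a good block among exponentially many well separated ones. -/
theorem le_measureReal_exists_mem (hκ : 0 ≤ κ) (hκ2 : κ < 1 / 2) (t : ℝ) (n M : ℕ)
    (hM : Real.exp (t ^ 2 * 2 ^ n) ≤ M) {E : Set (ℕ → ℝ)} (hE : MeasurableSet E)
    (hq : 1 / 2 ≤ P.real {x | (fun i => blockEnv n 0 (fun k => ω k x) i + t) ∈ E}) :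
    1 / (4 * (1 + Real.exp (t ^ 2))) ≤
      P.real {x | ∃ k < M, blockEnv n (k * 2 ^ n) (fun k => ω k x) ∈ E} := by
  have := hω.isProbabilityMeasure
  set K := 1 + Real.exp (t ^ 2)
  have hK : 0 < K := by positivity
  have hM0 : (0 : ℝ) < M := (Real.exp_pos _).trans_le hM
  set G := {x | ∃ k < M, blockEnv n (k * 2 ^ n) (fun k => ω k x) ∈ E}
  have hG : NullMeasurableSet G P := by
    have h1 : G = ⋃ k ∈ Finset.range M,
        (fun x => blockEnv n (k * 2 ^ n) fun k => ω k x) ⁻¹' E := by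
      ext x; simp [G]
    rw [h1]
    exact Finset.nullMeasurableSet_biUnion _ fun k _ =>
      ((measurable_blockEnv n _).comp_aemeasurable hω.aemeasurable_env).nullMeasurable hE
  let e : ℕ → Ω → ℝ := fun k x => Real.exp (tilt κ t n (k * 2 ^ n) fun k => ω k x)
  let W : Ω → ℝ := fun x => ∑ k ∈ Finset.range M, e k x
  have hW2 : ∀ x, W x ^ 2 = ∑ k ∈ Finset.range M, ∑ k' ∈ Finset.range M, e k x * e k' x :=
    fun x => by rw [sq, Finset.sum_mul_sum]
  have hee := fun k k' : ℕ => hω.integral_exp_tilt_mul_exp_tilt hκ t n (k * 2 ^ n) (k' * 2 ^ n)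
  have hW2i : Integrable (fun x => W x ^ 2) P := by
    simp only [hW2]
    exact integrable_finsetSum _ fun k _ => integrable_finsetSum _ fun k' _ => (hee k k').1
  have hv := avgVar_pos hκ n
  have hvinv : (avgVar κ n)⁻¹ ≤ 2 ^ n := by
    rw [inv_le_comm₀ hv (by positivity)]
    exact inv_two_pow_le_avgVar hκ n
  have hpair : ∀ k k' : ℕ, ∫ x, e k x * e k' x ∂P ≤
      Real.exp (t ^ 2) + if k = k' then Real.exp (t ^ 2 * 2 ^ n) else 0 := by
    intro k k'
    rw [(hee k k').2]
    have h2 : (k * 2 ^ n = k' * 2 ^ n) ↔ k = k' := by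
      simp
    simp only [h2]
    split_ifs with hk
    · refine le_add_of_nonneg_of_le (Real.exp_pos _).le (Real.exp_le_exp.2 ?_)
      rw [show t ^ 2 / avgVar κ n ^ 2 * avgVar κ n = t ^ 2 * (avgVar κ n)⁻¹ by field_simp]
      gcongr
    · rw [add_zero]
      refine Real.exp_le_exp.2 ?_
      -- Spacing the blocks by 2^n indices gives covariance at most 4^(-n), which offsets the factor
      -- 4^n from the inverse squared variance.
      have h3 : n ≤ treeDist (k * 2 ^ n) (k' * 2 ^ n) := by
        by_contra hcon
        have h4 := treeDist_le_iff.1 (not_le.1 hcon).le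
        simp only [Nat.mul_div_cancel _ (show 0 < 2 ^ n by positivity)] at h4
        exact hk h4
      have h5 : κ ^ (n + treeDist (k * 2 ^ n) (k' * 2 ^ n)) ≤ (1 / 2) ^ (n + n) :=
        (pow_le_pow_of_le_one hκ (by linarith) (by omega)).trans
          (pow_le_pow_left₀ hκ hκ2.le _)
      calc _ = t ^ 2 * (((avgVar κ n)⁻¹) ^ 2 * κ ^ (n + treeDist (k * 2 ^ n) (k' * 2 ^ n))) := by
            field_simp
        _ ≤ t ^ 2 * ((2 ^ n) ^ 2 * (1 / 2) ^ (n + n)) := by gcongr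
        _ = t ^ 2 * (2 ^ n * (1 / 2) ^ n) ^ 2 := by ring
        _ = t ^ 2 := by
            rw [← mul_pow 2 (1 / 2 : ℝ) n]
            norm_num
  have hW2le : ∫ x, W x ^ 2 ∂P ≤ K * M ^ 2 := by
    simp only [hW2]
    rw [integral_finsetSum _ fun k _ => integrable_finsetSum _ fun k' _ => (hee k k').1]
    calc _ ≤ ∑ k ∈ Finset.range M, ∑ k' ∈ Finset.range M,
          (Real.exp (t ^ 2) + if k = k' then Real.exp (t ^ 2 * 2 ^ n) else 0) := by
          refine Finset.sum_le_sum fun k _ => ?_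
          rw [integral_finsetSum _ fun k' _ => (hee k k').1]
          exact Finset.sum_le_sum fun k' _ => hpair k k'
      _ ≤ ∑ k ∈ Finset.range M, (M * Real.exp (t ^ 2) + M) := by
          refine Finset.sum_le_sum fun k hk => ?_
          rw [Finset.sum_add_distrib, Finset.sum_ite_eq, if_pos hk]
          simpa using hM
      _ = K * M ^ 2 := by
          simp [K]
          ring
  -- Off G no block is good and the left side vanishes; on G the indicators are dropped and W is
  -- truncated.
  have hpt : ∀ x, ∑ k ∈ Finset.range M,
      e k x * E.indicator (fun _ => (1 : ℝ)) (blockEnv n (k * 2 ^ n) fun k => ω k x) ≤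
      G.indicator (fun _ => K * M) x + W x ^ 2 * (4 * K * M)⁻¹ := by
    intro x
    by_cases hx : x ∈ G
    · rw [Set.indicator_of_mem hx]
      refine le_trans (Finset.sum_le_sum fun k _ => ?_) (le_mul_add_sq_mul_inv hK hM0)
      exact mul_le_of_le_one_right (Real.exp_pos _).le
        (Set.indicator_le' (fun _ _ => le_rfl) (fun _ _ => zero_le_one) _)
    · rw [Set.indicator_of_notMem hx, zero_add]
      refine (Finset.sum_eq_zero fun k hk => ?_).trans_le (by positivity)
      have : (blockEnv n (k * 2 ^ n) fun k => ω k x) ∉ E := fun h =>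
        hx ⟨k, Finset.mem_range.1 hk, h⟩
      simp [this]
  have hei : ∀ k ∈ Finset.range M, Integrable (fun x =>
      e k x * E.indicator (fun _ => (1 : ℝ)) (blockEnv n (k * 2 ^ n) fun k => ω k x)) P := by
    intro k _
    refine (hω.integrable_exp_tilt t n (k * 2 ^ n)).mono' ?_ (ae_of_all _ fun x => ?_)
    · exact (hω.integrable_exp_tilt t n _).aestronglyMeasurable.mul
        ((measurable_const.indicator hE).comp_aemeasurable
          ((measurable_blockEnv n _).comp_aemeasurable hω.aemeasurable_env)).aestronglyMeasurable
    · rw [Real.norm_eq_abs, abs_of_nonneg (mul_nonneg (Real.exp_pos _).le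
        (Set.indicator_nonneg (fun _ _ => zero_le_one) _))]
      exact mul_le_of_le_one_right (Real.exp_pos _).le
        (Set.indicator_le' (fun _ _ => le_rfl) (fun _ _ => zero_le_one) _)
  have hmain := integral_mono (integrable_finsetSum _ hei)
    (((integrable_const (K * M)).indicator₀ hG).add (hW2i.mul_const (4 * K * M)⁻¹)) hpt
  rw [integral_finsetSum _ hei, Finset.sum_congr rfl fun k _ =>
    hω.integral_indicator_mul_exp_tilt hκ t n (k * 2 ^ n) hE,
    integral_add' ((integrable_const _).indicator₀ hG) (hW2i.mul_const _), integral_mul_const,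
    integral_indicator₀ hG, setIntegral_const, Finset.sum_const, Finset.card_range,
    nsmul_eq_mul, smul_eq_mul] at hmain
  have h1 : (∫ x, W x ^ 2 ∂P) * (4 * K * M)⁻¹ ≤ M / 4 := by
    calc _ ≤ K * M ^ 2 * (4 * K * M)⁻¹ := by gcongr
      _ = M / 4 := by field_simp
  have h2 : (M : ℝ) * (1 / 2) ≤ P.real G * (K * M) + M / 4 := by
    refine le_trans ?_ (hmain.trans (by linarith))
    gcongr
  rw [div_le_iff₀ (by positivity)]
  have h3 : (M : ℝ) * 1 ≤ M * (P.real G * (4 * K)) := by linarith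
  exact le_of_mul_le_mul_left h3 hM0

end IsHierarchicalDisorder

/-! ### The smoothing inequality -/

variable {Ω : Type*} [MeasurableSpace Ω] {P : Measure Ω} {ω : ℕ → Ω → ℝ} {κ B : ℝ}

namespace IsHierarchicalDisorder

variable (hω : IsHierarchicalDisorder κ ω P)
include hω

/-- Almost sure convergence implies convergence in probability; F/2 leaves room for the deviation
and is the source of the factor 2 in the final constant. -/
theorem eventually_half_le_measureReal (hB : 1 < B) (hκ : 0 ≤ κ) (hκ2 : κ < 1 / 2) {β h : ℝ}
    (hF : 0 < freeEnergy B ω P β h) :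
    ∀ᶠ n : ℕ in atTop, 1 / 2 ≤ P.real {x | 2 ^ n * (freeEnergy B ω P β h / 2) ≤
      logZ B β h n 0 fun k => ω k x} := by
  have := hω.isProbabilityMeasure
  set F := freeEnergy B ω P β h
  have hm : ∀ n : ℕ, AEStronglyMeasurable (fun x => logPartitionFunction B β h ω n x / 2 ^ n) P :=
    fun n => ((hω.aemeasurable_logZ B β h n 0).div_const _).aestronglyMeasurable
  have h1 := tendstoInMeasure_of_tendsto_ae hm (hω.ae_tendsto_logPartitionFunction hB hκ hκ2 β h)
  have h2 := (tendstoInMeasure_iff_measureReal_dist.1 h1) (F / 2) (by positivity)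
  filter_upwards [h2.eventually_lt_const (show (0 : ℝ) < 1 / 2 by norm_num)] with n hn
  have h3 : (Set.univ : Set Ω) ⊆ {x | 2 ^ n * (F / 2) ≤ logZ B β h n 0 fun k => ω k x} ∪
      {x | F / 2 ≤ dist (logPartitionFunction B β h ω n x / 2 ^ n) F} := by
    intro x _
    by_contra hx
    simp only [Set.mem_union, Set.mem_ofPred_eq, not_or, not_le] at hx
    obtain ⟨hx1, hx2⟩ := hx
    have h4 : logPartitionFunction B β h ω n x / 2 ^ n < F / 2 := by
      rw [div_lt_iff₀ (by positivity), mul_comm]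
      exact hx1
    rw [Real.dist_eq, abs_lt] at hx2
    linarith
  have h4 := (measureReal_mono (μ := P) h3).trans (measureReal_union_le _ _)
  rw [probReal_univ] at h4
  linarith

/-- The smoothing inequality, in terms of the shift `t` of the disorder. -/
theorem freeEnergy_le_of_freeEnergy_eq_zero (hB : 1 < B) (hκ : 0 ≤ κ) (hκ2 : κ < 1 / 2)
    {β h t : ℝ} (h0 : freeEnergy B ω P β h = 0) :
    freeEnergy B ω P β (h + β * t) ≤ 2 * Real.log (B ^ 2 / (B - 1)) / Real.log 2 * t ^ 2 := by
  have := hω.isProbabilityMeasure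
  have hB1 : 0 < B - 1 := by linarith
  set C := Real.log (B ^ 2 / (B - 1))
  have hC : 0 ≤ C := Real.log_nonneg ((one_le_div hB1).2 (by nlinarith))
  have hl2 : 0 < Real.log 2 := Real.log_pos one_lt_two
  rcases (hω.freeEnergy_nonneg hB β (h + β * t)).eq_or_lt with hF | hF
  · rw [← hF]; positivity
  set F := freeEnergy B ω P β (h + β * t)
  set p := 1 / (4 * (1 + Real.exp (t ^ 2)))
  have hp : 0 < p := by positivity
  set c := -Real.log ((B - 1) / B)
  have hc : 0 ≤ c := neg_nonneg.2 (Real.log_nonpos (by positivity)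
    ((div_le_one (by linarith)).2 (by linarith)))
  set Q := (Real.log B + c) / p
  have hQ : 0 ≤ Q := div_nonneg (add_nonneg (Real.log_nonneg hB.le) hc) hp.le
  have hev : ∀ᶠ n : ℕ in atTop,
      F / 2 ≤ t ^ 2 * C / Real.log 2 + (C * (n / 2 ^ n) + (C + Q) / 2 ^ n) := by
    filter_upwards [hω.eventually_half_le_measureReal hB hκ hκ2 hF, eventually_ge_atTop 1]
      with n hn hn1
    obtain ⟨l, rfl⟩ := Nat.exists_eq_add_of_le' hn1
    set n := l + 1
    -- The least number of generations for which 2^m ≥ exp(t² 2^n).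
    set m := ⌈t ^ 2 * 2 ^ n / Real.log 2⌉₊
    have hm : Real.exp (t ^ 2 * 2 ^ n) ≤ (2 ^ m : ℕ) := by
      have h1 : t ^ 2 * 2 ^ n ≤ m * Real.log 2 := by
        rw [← div_le_iff₀ hl2]; exact Nat.le_ceil _
      calc _ ≤ Real.exp (m * Real.log 2) := Real.exp_le_exp.2 h1
        _ = _ := by
          rw [← Real.log_pow, Real.exp_log (by positivity)]
          norm_cast
    have hm2 : (m : ℝ) ≤ t ^ 2 * 2 ^ n / Real.log 2 + 1 :=
      (Nat.ceil_lt_add_one (by positivity)).le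
    let E : Set (ℕ → ℝ) := {u | 2 ^ n * (F / 2) ≤ logZ B β h n 0 u}
    have hE : MeasurableSet E := measurableSet_le measurable_const (measurable_logZ B β h n 0)
    have hgood := hω.le_measureReal_exists_mem hκ hκ2 t n (2 ^ m) hm hE (by
      simpa only [E, Set.mem_ofPred_eq, logZ_add_const, logZ_blockEnv] using hn)
    set G := {x | ∃ k < 2 ^ m, blockEnv n (k * 2 ^ n) (fun k => ω k x) ∈ E}
    have hG : NullMeasurableSet G P := by
      have h1 : G = ⋃ k ∈ Finset.range (2 ^ m),
          (fun x => blockEnv n (k * 2 ^ n) fun k => ω k x) ⁻¹' E := by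
        ext x; simp [G]
      rw [h1]
      exact Finset.nullMeasurableSet_biUnion _ fun k _ =>
        ((measurable_blockEnv n _).comp_aemeasurable hω.aemeasurable_env).nullMeasurable hE
    -- Net gain from a good block after climbing n + m generations: n for the spacing of the blocks,
    -- m for their number.
    set b := 2 ^ n * (F / 2) - (n + m : ℕ) * C
    have hb : b ≤ Q := by
      rcases le_total b 0 with hb0 | hb0
      · exact hb0.trans hQ
      have hpt : ∀ x, G.indicator (fun _ => b) x - c ≤
          logZ B β h (n + (n + m)) 0 fun k => ω k x := by
        intro x
        by_cases hx : x ∈ G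
        · rw [Set.indicator_of_mem hx]
          obtain ⟨k, hk, hkE⟩ := hx
          have h1 : 2 ^ n * (F / 2) ≤ logZ B β h n (k * 2 ^ n) fun k => ω k x := by
            rw [← logZ_blockEnv]; exact hkE
          have h2 := logZ_sub_le_logZ_add (β := β) (h := h) hB (fun k => ω k x) l (n + m)
            (k * 2 ^ n)
          have h3 : k * 2 ^ n / 2 ^ (n + m) = 0 := by
            refine Nat.div_eq_of_lt ?_
            rw [pow_add 2 n m, mul_comm (2 ^ n)]
            exact Nat.mul_lt_mul_of_pos_right hk (by positivity)
          rw [h3] at h2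
          change logZ B β h n _ _ - ((n + m : ℕ) : ℝ) * C ≤ logZ B β h (n + (n + m)) 0 _ at h2
          simp only [b]
          linarith
        · rw [Set.indicator_of_notMem hx, zero_sub, neg_neg]
          have h2 := le_logZ_succ (β := β) (h := h) hB (fun k => ω k x) (n + m + l) 0
          rwa [show n + m + l + 1 = n + (n + m) by omega] at h2
      have h1 := integral_mono (((integrable_const b).indicator₀ hG).sub (integrable_const c))
        (hω.integrable_logZ hB β h (n + (n + m)) 0) hpt
      rw [integral_sub' ((integrable_const b).indicator₀ hG) (integrable_const c),
        integral_indicator₀ hG, setIntegral_const, integral_const, probReal_univ, one_smul,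
        smul_eq_mul] at h1
      -- Zero free energy bounds this mean by log B, so pb ≤ log B + c, uniformly in n.
      have h2 := hω.integral_logZ_sub_log_div_le hB β h (n + (n + m))
      rw [h0, div_le_iff₀ (by positivity), zero_mul] at h2
      have h3 : p * b ≤ P.real G * b := by gcongr
      rw [le_div_iff₀ hp]
      linarith
    have h1 : F / 2 * 2 ^ n ≤ (t ^ 2 * C / Real.log 2 + (C * (n / 2 ^ n) + (C + Q) / 2 ^ n)) * 2 ^ n := by
      have h2 : (t ^ 2 * C / Real.log 2 + (C * (n / 2 ^ n) + (C + Q) / 2 ^ n)) * 2 ^ n =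
          n * C + (t ^ 2 * 2 ^ n / Real.log 2 + 1) * C + Q := by
        field_simp
        ring
      rw [h2]
      have h3 := mul_le_mul_of_nonneg_right hm2 hC
      have h4 : b = 2 ^ n * (F / 2) - (n + m) * C := by simp only [b, Nat.cast_add]
      linarith
    exact le_of_mul_le_mul_right h1 (by positivity)
  have hlim : Tendsto (fun n : ℕ => t ^ 2 * C / Real.log 2 + (C * (n / 2 ^ n) + (C + Q) / 2 ^ n))
      atTop (𝓝 (t ^ 2 * C / Real.log 2)) := by
    have h1 : Tendsto (fun n : ℕ => (n : ℝ) / 2 ^ n) atTop (𝓝 0) := by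
      simpa using tendsto_pow_const_div_const_pow_of_one_lt 1 (one_lt_two (α := ℝ))
    have h2 : Tendsto (fun n : ℕ => (C + Q) / 2 ^ n) atTop (𝓝 0) :=
      tendsto_const_nhds.div_atTop (tendsto_pow_atTop_atTop_of_one_lt one_lt_two)
    simpa using tendsto_const_nhds.add ((h1.const_mul C).add h2)
  have h1 := ge_of_tendsto hlim hev
  calc F ≤ 2 * (t ^ 2 * C / Real.log 2) := by linarith
    _ = _ := by ring

theorem freeEnergy_le_smoothing (hB : 1 < B) (hκ : 0 ≤ κ) (hκ2 : κ < 1 / 2) {β : ℝ} (hβ : 0 < β)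
    (h : ℝ) :
    freeEnergy B ω P β h ≤ 2 * Real.log (B ^ 2 / (B - 1)) / Real.log 2 / β ^ 2 *
      max (h - criticalPoint B ω P β) 0 ^ 2 := by
  rcases le_total h (criticalPoint B ω P β) with hh | hh
  · rw [hω.freeEnergy_eq_zero_of_le_criticalPoint hB hκ hκ2 hh, max_eq_right (by linarith)]
    simp
  · have h1 := hω.freeEnergy_le_of_freeEnergy_eq_zero hB hκ hκ2
      (β := β) (h := criticalPoint B ω P β) (t := (h - criticalPoint B ω P β) / β)
      (hω.freeEnergy_eq_zero_of_le_criticalPoint hB hκ hκ2 le_rfl)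
    rw [mul_div_cancel₀ _ hβ.ne', add_sub_cancel] at h1
    rw [max_eq_left (by linarith)]
    refine h1.trans_eq ?_
    field_simp

end IsHierarchicalDisorder

/-! ### Exponents from a quadratic bound -/

theorem eventually_le_log_div_log {f : ℝ → ℝ} {C x₀ : ℝ} (hpos : ∀ x, x₀ < x → 0 < f x)
    (hle : ∀ x, x₀ < x → f x ≤ C * (x - x₀) ^ 2) {a : ℝ} (ha : a < 2) :
    ∀ᶠ x in 𝓝[>] x₀, a ≤ Real.log (f x) / Real.log (x - x₀) := by
  have hsub : Tendsto (fun x => x - x₀) (𝓝[>] x₀) (𝓝[>] 0) := by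
    refine tendsto_nhdsWithin_iff.2 ⟨?_, ?_⟩
    · have : Tendsto (fun x => x - x₀) (𝓝 x₀) (𝓝 (x₀ - x₀)) :=
        tendsto_id.sub_const x₀
      rw [sub_self] at this
      exact this.mono_left nhdsWithin_le_nhds
    · filter_upwards [self_mem_nhdsWithin] with x hx
      exact Set.mem_Ioi.2 (sub_pos.2 (Set.mem_Ioi.1 hx))
  have hlog := Real.tendsto_log_nhdsGT_zero.comp hsub
  -- The logarithm of x - x₀ is negative, which reverses the inequality on division; the second
  -- threshold lets (2 - a)|log(x - x₀)| absorb |log C|.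
  filter_upwards [self_mem_nhdsWithin, hlog.eventually_lt_atBot 0,
    hlog.eventually_le_atBot (-(|Real.log C| / (2 - a)))] with x hx h1 h2
  simp only [Function.comp_apply] at h1 h2
  have hx0 : 0 < x - x₀ := sub_pos.2 hx
  have hC : 0 < C := by
    by_contra hC
    exact absurd ((hpos x hx).trans_le (hle x hx))
      (not_lt.2 (mul_nonpos_of_nonpos_of_nonneg (not_lt.1 hC) (sq_nonneg _)))
  have h3 := Real.log_le_log (hpos x hx) (hle x hx)
  rw [Real.log_mul hC.ne' (by positivity), Real.log_pow] at h3
  rw [le_div_iff_of_neg h1]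
  refine h3.trans ?_
  push_cast
  rw [le_neg, div_le_iff₀ (by linarith)] at h2
  linarith [le_abs_self (Real.log C)]

/-- The quotient is at most C(x - x₀)^(2 - ν), a positive power. -/
theorem tendsto_div_rpow_zero {f : ℝ → ℝ} {C x₀ : ℝ} (hnonneg : ∀ x, 0 ≤ f x)
    (hle : ∀ x, x₀ < x → f x ≤ C * (x - x₀) ^ 2) {ν : ℝ} (hν : ν < 2) :
    Tendsto (fun x => f x / (x - x₀) ^ ν) (𝓝[>] x₀) (𝓝 0) := by
  have hlim : Tendsto (fun x => C * (x - x₀) ^ (2 - ν)) (𝓝[>] x₀) (𝓝 0) := by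
    have h1 : ContinuousAt (fun x => C * (x - x₀) ^ (2 - ν)) x₀ := by
      refine continuousAt_const.mul (ContinuousAt.rpow_const (by fun_prop) (Or.inr (by linarith)))
    have h2 := h1.tendsto
    rw [sub_self, Real.zero_rpow (by linarith), mul_zero] at h2
    exact h2.mono_left nhdsWithin_le_nhds
  refine tendsto_of_tendsto_of_tendsto_of_le_of_le' tendsto_const_nhds hlim ?_ ?_
  · filter_upwards [self_mem_nhdsWithin] with x hx
    have hx0 : 0 < x - x₀ := sub_pos.2 hx
    have := hnonneg x
    positivity
  · filter_upwards [self_mem_nhdsWithin] with x hx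
    have hx0 : 0 < x - x₀ := sub_pos.2 hx
    rw [div_le_iff₀ (by positivity), mul_assoc, ← Real.rpow_add hx0, sub_add_cancel]
    exact_mod_cast hle x hx

end HierPinning

theorem proposition3p4 (B : ℝ) (hB₁ : 1 < B) (hB₂ : B < 2) :
    ∃ c : ℝ, ∀ (κ : ℝ), 0 ≤ κ → κ < 1 / 2 →
      ∀ {Ω : Type*} [MeasurableSpace Ω] (P : Measure Ω) (ω : ℕ → Ω → ℝ),
        HierPinning.IsHierarchicalDisorder κ ω P →
        ∀ β : ℝ, 0 < β →
          -- the free energy is a genuine limit, of the expectations and almost surely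
          (∀ h : ℝ,
            (∀ n : ℕ, Integrable (HierPinning.logPartitionFunction B β h ω n) P) ∧
            Tendsto (HierPinning.finiteFreeEnergy B ω P β h) atTop
              (𝓝 (HierPinning.freeEnergy B ω P β h)) ∧
            (∀ᵐ x ∂P, Tendsto (fun n : ℕ => HierPinning.logPartitionFunction B β h ω n x / 2 ^ n)
              atTop (𝓝 (HierPinning.freeEnergy B ω P β h)))) ∧
          -- the critical point separates the zeros of the free energy from its positive values
          (∀ h : ℝ,
            (h ≤ HierPinning.criticalPoint B ω P β → HierPinning.freeEnergy B ω P β h = 0) ∧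
            (HierPinning.criticalPoint B ω P β < h → 0 < HierPinning.freeEnergy B ω P β h)) ∧
          -- the smoothing inequality
          (∀ h : ℝ,
            HierPinning.freeEnergy B ω P β h ≤
              c / β ^ 2 * (max (h - HierPinning.criticalPoint B ω P β) 0) ^ 2) ∧
          -- the quenched critical exponent is at least 2
          (∀ a : ℝ, a < 2 →
            ∀ᶠ h in 𝓝[>] (HierPinning.criticalPoint B ω P β),
              a ≤ Real.log (HierPinning.freeEnergy B ω P β h) /
                Real.log (h - HierPinning.criticalPoint B ω P β)) ∧
          -- disorder is relevant if the pure exponent is smaller than 2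
          (HierPinning.pureExponent B < 2 →
            Tendsto
              (fun h : ℝ => HierPinning.freeEnergy B ω P β h /
                (h - HierPinning.criticalPoint B ω P β) ^ HierPinning.pureExponent B)
              (𝓝[>] (HierPinning.criticalPoint B ω P β)) (𝓝 0)) := by
  refine ⟨2 * Real.log (B ^ 2 / (B - 1)) / Real.log 2, fun κ hκ hκ2 Ω _ P ω hω β hβ => ?_⟩
  have hsmooth := hω.freeEnergy_le_smoothing hB₁ hκ hκ2 hβ
  have hpos : ∀ h, HierPinning.criticalPoint B ω P β < h → 0 < HierPinning.freeEnergy B ω P β h :=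
    fun h hh => hω.freeEnergy_pos_of_criticalPoint_lt hB₁ hh
  have hle : ∀ h, HierPinning.criticalPoint B ω P β < h → HierPinning.freeEnergy B ω P β h ≤
      2 * Real.log (B ^ 2 / (B - 1)) / Real.log 2 / β ^ 2 *
        (h - HierPinning.criticalPoint B ω P β) ^ 2 := fun h hh => by
    have h1 := hsmooth h
    rwa [max_eq_left (sub_pos.2 hh).le] at h1
  exact ⟨fun h => ⟨fun n => hω.integrable_logZ hB₁ β h n 0, hω.tendsto_finiteFreeEnergy hB₁ β h,
      hω.ae_tendsto_logPartitionFunction hB₁ hκ hκ2 β h⟩,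
    fun h => ⟨fun hh => hω.freeEnergy_eq_zero_of_le_criticalPoint hB₁ hκ hκ2 hh, hpos h⟩,
    hsmooth, fun a ha => HierPinning.eventually_le_log_div_log hpos hle ha,
    fun hν => HierPinning.tendsto_div_rpow_zero (hω.freeEnergy_nonneg hB₁ β) hle hν⟩
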